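/- For an integer $\nu>1$ let $\mathcal H_\nu$ be the Hilbert space of holomorphic functions $f$ on the unit disc $\mathbb D$ with $$\|f\|_\nu^2=\frac{\nu-1}{\pi}\int_{\mathbb D}|f(z)|^2(1-|z|^2)^{\nu-2}\,dz<\infty .$$ Write $(a)_j=a(a+1)\cdots(a+j-1)$. Let $\mu,\nu>1$ and $k\ge 0$ be integers, and let $P_k\colon\mathcal H_\mu\otimes\mathcal H_\nu\to\mathcal H_{\mu+\nu+2k}$ (Hilbert space tensor product) be the bounded operator determined by $$P_k(f\otimes g)(\zeta)=C_{\mu,\nu,k}\sum_{j=0}^{k}(-1)^j\binom kj\frac{1}{(\mu)_j(\nu)_{k-j}}\,f^{(j)}(\zeta)\,g^{(k-j)}(\zeta),\qquad C_{\mu,\nu,k}=\left(\frac{(\mu)_k(\nu)_k}{k!\,(\mu+\nu+k-1)_k}\right)^{1/2}\!,$$ which satisfies $P_kP_k^*=I$, i.e. $P_k$ is the projection onto the component $\mathcal H_{\mu+\nu+2k}$ of $\mathcal H_\mu\otimes\mathcal H_\nu\cong\bigoplus_{k\ge0}\mathcal H_{\mu+\nu+2k}$. Define $$\mathcal T^\nu_{\mu,k}\colon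 B(\mathcal H_\mu)\to B(\mathcal H_{\mu+\nu+2k}),\qquad \mathcal T^\nu_{\mu,k}(A)=P_k(A\otimes I_\nu)P_k^*,$$ where $I_\nu$ is the identity on $\mathcal H_\nu$. Then $\mathcal T^\nu_{\mu,k}$ is completely positive. Moreover, if $A\in B(\mathcal H_\mu)$ is of trace class, then $\mathcal T^\nu_{\mu,k}(A)$ is of trace class, and $$\operatorname{Tr}\,\mathcal T^\nu_{\mu,k}(A)=\frac{\mu+\nu+2k-1}{\mu-1}\operatorname{Tr}A .$$ -/

import Mathlib

noncomputable section

namespace SU11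

open MeasureTheory Metric Complex
open scoped ComplexConjugate TensorProduct InnerProductSpace

/-- The open unit disc. -/
abbrev 𝔻 : Set ℂ := ball (0 : ℂ) 1

/-- The measure `dι_ν(z) = (1 - |z|²)^ν (ν - 1) dz / (π (1 - |z|²)²)` on the unit disc, where `dz` is
Lebesgue measure; it is regarded as a measure on `ℂ` that is carried by the disc. -/
def iota (ν : ℕ) : Measure ℂ :=
  (volume.restrict 𝔻).withDensity fun z =>
    ENNReal.ofReal ((1 - ‖z‖ ^ 2) ^ ν * ((ν - 1 : ℝ) / (Real.pi * (1 - ‖z‖ ^ 2) ^ 2)))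

/-- The holomorphic functions on the unit disc that are square integrable with respect to `dι_ν`. A
function on the disc is represented by its extension by zero to `ℂ`. -/
def holL2 (ν : ℕ) : Submodule ℂ (ℂ → ℂ) where
  carrier := {f | DifferentiableOn ℂ f 𝔻 ∧ (∀ z, z ∉ 𝔻 → f z = 0) ∧ MemLp f 2 (iota ν)}
  add_mem' {f g} hf hg :=
    ⟨hf.1.add hg.1, fun z hz => by simp [hf.2.1 z hz, hg.2.1 z hz], hf.2.2.add hg.2.2⟩
  zero_mem' := ⟨differentiableOn_const 0, fun _ _ => rfl, MemLp.zero⟩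
  smul_mem' c f hf :=
    ⟨hf.1.const_smul c, fun z hz => by simp [hf.2.1 z hz], hf.2.2.const_smul c⟩

/-- The weighted Bergman space `𝓗_ν`. -/
def Bergman (ν : ℕ) : Type := holL2 ν

instance (ν : ℕ) : AddCommGroup (Bergman ν) := inferInstanceAs (AddCommGroup (holL2 ν))

instance (ν : ℕ) : Module ℂ (Bergman ν) := inferInstanceAs (Module ℂ (holL2 ν))

instance (ν : ℕ) : FunLike (Bergman ν) ℂ ℂ where
  coe f := f.1
  coe_injective _ _ h := Subtype.ext h

section Space

variable {ν : ℕ}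

theorem coe_add (f g : Bergman ν) : ⇑(f + g) = ⇑f + ⇑g := rfl

theorem coe_smul (c : ℂ) (f : Bergman ν) : ⇑(c • f) = c • ⇑f := rfl

theorem coe_sub (f g : Bergman ν) : ⇑(f - g) = ⇑f - ⇑g := rfl

theorem diffOn (f : Bergman ν) : DifferentiableOn ℂ f 𝔻 := f.2.1

theorem eq_zero_of_notMem (f : Bergman ν) {z : ℂ} (hz : z ∉ 𝔻) : f z = 0 := f.2.2.1 z hz

theorem memLp (f : Bergman ν) : MemLp f 2 (iota ν) := f.2.2.2

theorem measurable_density (ν : ℕ) : Measurable fun z : ℂ =>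
    ENNReal.ofReal ((1 - ‖z‖ ^ 2) ^ ν * ((ν - 1 : ℝ) / (Real.pi * (1 - ‖z‖ ^ 2) ^ 2))) := by
  fun_prop

theorem one_sub_pos {z : ℂ} (hz : z ∈ 𝔻) : 0 < 1 - ‖z‖ ^ 2 := by
  have h : ‖z‖ < 1 := by simpa using hz
  nlinarith [norm_nonneg z]

theorem density_pos (hν : 1 < ν) {z : ℂ} (hz : z ∈ 𝔻) :
    0 < (1 - ‖z‖ ^ 2) ^ ν * ((ν - 1 : ℝ) / (Real.pi * (1 - ‖z‖ ^ 2) ^ 2)) := by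
  have h := one_sub_pos hz
  have h' : (0 : ℝ) < ν - 1 := by
    have : (1 : ℝ) < ν := by exact_mod_cast hν
    linarith
  have := Real.pi_pos
  positivity

theorem density_eq (m : ℕ) {z : ℂ} (hz : z ∈ 𝔻) :
    (1 - ‖z‖ ^ 2) ^ (m + 2) * ((((m + 2 : ℕ) : ℝ) - 1) / (Real.pi * (1 - ‖z‖ ^ 2) ^ 2))
      = (m + 1) / Real.pi * (1 - ‖z‖ ^ 2) ^ m := by
  have h := (one_sub_pos hz).ne'
  have := Real.pi_pos.ne'
  push_cast
  field_simp
  ring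

theorem volume_ac (hν : 1 < ν) : (volume.restrict 𝔻) ≪ iota ν := by
  refine withDensity_absolutelyContinuous' (measurable_density ν).aemeasurable ?_
  filter_upwards [ae_restrict_mem measurableSet_ball] with z hz
  simpa using density_pos hν hz

theorem integral_iota (ν : ℕ) (hν : 1 < ν) (g : ℂ → ℂ) : ∫ z, g z ∂iota ν =
    ∫ z in 𝔻, ((1 - ‖z‖ ^ 2) ^ ν * ((ν - 1 : ℝ) / (Real.pi * (1 - ‖z‖ ^ 2) ^ 2))) • g z := by
  rw [iota, integral_withDensity_eq_integral_toReal_smul (measurable_density ν) (by simp)]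
  refine setIntegral_congr_fun measurableSet_ball fun z hz => ?_
  rw [ENNReal.toReal_ofReal (density_pos hν hz).le]

theorem isFiniteMeasure_iota (hν : 1 < ν) : IsFiniteMeasure (iota ν) := by
  obtain ⟨m, rfl⟩ : ∃ m, ν = m + 2 := ⟨ν - 2, by omega⟩
  refine isFiniteMeasure_withDensity (ne_of_lt ?_)
  calc _ ≤ ∫⁻ z in 𝔻, ENNReal.ofReal ((m + 1) / Real.pi) := by
        refine setLIntegral_mono measurable_const fun z hz => ENNReal.ofReal_le_ofReal ?_
        rw [density_eq m hz]
        have h := one_sub_pos hz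
        have h1 : (1 - ‖z‖ ^ 2) ^ m ≤ 1 := pow_le_one₀ h.le (by nlinarith [norm_nonneg z])
        exact mul_le_of_le_one_right (by positivity) h1
    _ < ⊤ := by
        rw [setLIntegral_const]
        exact ENNReal.mul_lt_top ENNReal.ofReal_lt_top measure_ball_lt_top

theorem integrable_mul (f g : Bergman ν) : Integrable (fun z => conj (f z) * g z) (iota ν) :=
  (memLp f).star.integrable_mul (memLp g)

theorem eq_zero_of_ae (hν : 1 < ν) (f : Bergman ν) (h : f =ᵐ[iota ν] 0) : f = 0 := by
  have h1 : f =ᵐ[volume.restrict 𝔻] 0 := (volume_ac hν).ae_le h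
  have h2 := Measure.eqOn_open_of_ae_eq h1 isOpen_ball (diffOn f).continuousOn continuousOn_const
  refine DFunLike.ext _ _ fun z => ?_
  by_cases hz : z ∈ 𝔻
  · exact h2 hz
  · exact eq_zero_of_notMem f hz

/-- The inner product `⟨f, g⟩_ν = ∫ conj (f) g dι_ν`, conjugate linear in the first variable. -/
@[reducible]
def innerCore (hν : 1 < ν) : InnerProductSpace.Core ℂ (Bergman ν) where
  inner f g := ∫ z, conj (f z) * g z ∂iota ν
  conj_inner_symm f g := by
    rw [← integral_conj]
    simp [mul_comm]
  re_inner_nonneg f := by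
    have : ∀ z, conj (f z) * f z = ((‖f z‖ ^ 2 : ℝ) : ℂ) := fun z => by
      rw [Complex.conj_mul']; simp
    simp_rw [this, integral_complex_ofReal]
    exact integral_nonneg fun z => by positivity
  add_left f g h := by
    rw [← integral_add (integrable_mul f h) (integrable_mul g h)]
    simp [coe_add, add_mul]
  smul_left f g c := by
    rw [← integral_const_mul]
    simp [coe_smul, mul_assoc]
  definite f h := by
    have h1 : ∀ z, conj (f z) * f z = ((‖f z‖ ^ 2 : ℝ) : ℂ) := fun z => by
      rw [Complex.conj_mul']; simp
    simp_rw [h1, integral_complex_ofReal] at h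
    have h2 : ∫ z, ‖f z‖ ^ 2 ∂iota ν = 0 := by exact_mod_cast h
    rw [integral_eq_zero_iff_of_nonneg (fun z => by positivity)] at h2
    · refine eq_zero_of_ae hν f ?_
      filter_upwards [h2] with z hz
      simpa using hz
    · exact (memLp f).integrable_norm_pow (by norm_num)

end Space

instance (ν : ℕ) [h : Fact (1 < ν)] : NormedAddCommGroup (Bergman ν) :=
  @InnerProductSpace.Core.toNormedAddCommGroup ℂ (Bergman ν) _ _ _ (innerCore h.out)

instance (ν : ℕ) [h : Fact (1 < ν)] : InnerProductSpace ℂ (Bergman ν) :=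
  InnerProductSpace.ofCore (innerCore h.out).toCore

theorem inner_def {ν : ℕ} [Fact (1 < ν)] (f g : Bergman ν) :
    ⟪f, g⟫_ℂ = ∫ z, conj (f z) * g z ∂iota ν := rfl

section Coefficients

variable {ν : ℕ}

theorem integral_beta (m n : ℕ) :
    ∫ r in (0 : ℝ)..1, 2 * (m + 1) * r ^ (2 * n + 1) * (1 - r ^ 2) ^ m =
      (n.factorial : ℝ) / ((m + 2).ascFactorial n : ℝ) := by
  induction n with
  | zero =>
    have h := intervalIntegral.integral_eq_sub_of_hasDerivAt (a := 0) (b := 1)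
      (f := fun r : ℝ => -(1 - r ^ 2) ^ (m + 1))
      (f' := fun r : ℝ => 2 * (m + 1) * r ^ (2 * 0 + 1) * (1 - r ^ 2) ^ m)
      (fun r _ => by
        have := ((((hasDerivAt_id r).pow 2).const_sub 1).pow (m + 1)).neg
        refine this.congr_deriv ?_
        simp
        ring) (by apply Continuous.intervalIntegrable; fun_prop)
    rw [h]
    simp
  | succ n ih =>
    have h := intervalIntegral.integral_eq_sub_of_hasDerivAt (a := 0) (b := 1)
      (f := fun r : ℝ => r ^ (2 * n + 2) * (1 - r ^ 2) ^ (m + 1))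
      (f' := fun r : ℝ => (n + 1) / (m + 1) * (2 * (m + 1) * r ^ (2 * n + 1) * (1 - r ^ 2) ^ m)
        - (n + m + 2) / (m + 1) * (2 * (m + 1) * r ^ (2 * (n + 1) + 1) * (1 - r ^ 2) ^ m))
      (fun r _ => by
        have := (hasDerivAt_pow (2 * n + 2) r).mul
          ((((hasDerivAt_id r).pow 2).const_sub 1).pow (m + 1))
        refine this.congr_deriv ?_
        simp
        have : (m : ℝ) + 1 ≠ 0 := by positivity
        field_simp
        ring) (by apply Continuous.intervalIntegrable; fun_prop)
    rw [intervalIntegral.integral_sub (by apply Continuous.intervalIntegrable; fun_prop)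
      (by apply Continuous.intervalIntegrable; fun_prop),
      intervalIntegral.integral_const_mul, intervalIntegral.integral_const_mul, ih] at h
    simp only [one_pow, sub_self, ne_eq, Nat.add_eq_zero_iff, one_ne_zero, and_false,
      not_false_eq_true, zero_pow, mul_zero, OfNat.ofNat_ne_zero, zero_mul] at h
    have h1 : (m : ℝ) + 1 ≠ 0 := by positivity
    have h2 : (m : ℝ) + 2 + n ≠ 0 := by positivity
    have h3 : (((m + 2).ascFactorial n : ℕ) : ℝ) ≠ 0 := by
      exact_mod_cast (Nat.ascFactorial_pos _ _).ne'
    rw [Nat.ascFactorial_succ, Nat.factorial_succ]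
    push_cast at h ⊢
    field_simp at h ⊢
    linarith

/-- The Taylor coefficients at the origin. -/
def coeff (f : ℂ → ℂ) (n : ℕ) : ℂ := iteratedDeriv n f 0 / n.factorial

theorem angular (f : Bergman ν) (n : ℕ) {r : ℝ} (h0 : 0 < r) (h1 : r < 1) :
    ∫ θ in Set.Ioo (-Real.pi) Real.pi,
      conj ((r * exp (θ * I)) ^ n) * f (r * exp (θ * I)) =
      2 * Real.pi * r ^ (2 * n) * coeff f n := by
  have hd : DifferentiableOn ℂ f (closedBall 0 r) :=
    (diffOn f).mono (closedBall_subset_ball h1)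
  have h := DifferentiableOn.circleIntegral_one_div_sub_center_pow_smul h0 n hd
  have hr : (r : ℂ) ≠ 0 := by exact_mod_cast h0.ne'
  have hper : Function.Periodic (fun θ : ℝ =>
      conj ((r * exp (θ * I)) ^ n) * f (r * exp (θ * I))) (2 * Real.pi) := by
    intro θ
    have : exp (((θ + 2 * Real.pi : ℝ) : ℂ) * I) = exp (θ * I) := by
      have := Complex.exp_periodic (θ * I)
      rw [← this]
      congr 1
      push_cast
      ring
    simp only [this]
  rw [← integral_Ioc_eq_integral_Ioo, ← intervalIntegral.integral_of_le (by linarith [Real.pi_pos])]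
  have h2 := hper.intervalIntegral_add_eq (-Real.pi) 0
  rw [show -Real.pi + 2 * Real.pi = Real.pi by ring, zero_add] at h2
  rw [h2]
  rw [circleIntegral] at h
  have h3 : ∀ θ : ℝ, deriv (circleMap 0 r) θ •
      (1 / (circleMap 0 r θ - 0) ^ (n + 1)) • f (circleMap 0 r θ) =
      (I / r ^ (2 * n)) * (conj ((r * exp (θ * I)) ^ n) * f (r * exp (θ * I))) := by
    intro θ
    have hc : conj (exp (θ * I)) = (exp (θ * I))⁻¹ := by
      rw [← exp_conj, ← exp_neg]
      simp
    have he := exp_ne_zero (θ * I)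
    simp only [deriv_circleMap, circleMap, zero_add, sub_zero, smul_eq_mul, map_pow, map_mul, hc,
      conj_ofReal]
    simp only [mul_pow, inv_pow]
    field_simp
    ring
  simp_rw [h3] at h
  rw [intervalIntegral.integral_const_mul] at h
  have hI := I_ne_zero
  rw [coeff]
  rw [smul_eq_mul, div_mul_eq_mul_div, div_mul_eq_mul_div, div_eq_iff (by positivity)] at h
  apply mul_left_cancel₀ hI
  rw [h]
  ring

theorem mem_disc_polar {r : ℝ} (h0 : 0 < r) (θ : ℝ) : (r * exp (θ * I) : ℂ) ∈ 𝔻 ↔ r < 1 := by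
  simp [abs_of_pos h0, Complex.norm_exp_ofReal_mul_I]

theorem integral_monomial_mul (hν : 1 < ν) (f : Bergman ν) (n : ℕ) :
    ∫ z, conj (z ^ n) * f z ∂iota ν = (n.factorial : ℂ) / (ν.ascFactorial n : ℂ) * coeff f n := by
  obtain ⟨m, rfl⟩ : ∃ m, ν = m + 2 := ⟨ν - 2, by omega⟩
  set ρ : ℝ → ℝ := fun r => (m + 1) / Real.pi * (1 - r ^ 2) ^ m with hρ
  set G : ℂ → ℂ := fun z => ρ ‖z‖ • (conj (z ^ n) * f z) with hG
  have hfin := isFiniteMeasure_iota hν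
  have hGc : ContinuousOn G 𝔻 := by
    have := (diffOn f).continuousOn
    simp only [hG, hρ]
    fun_prop
  have hint : IntegrableOn G 𝔻 := by
    have hI : Integrable (fun z => conj (z ^ n) * f z) (iota (m + 2)) := by
      refine ((memLp f).integrable (by norm_num)).norm.mono' ?_ ?_
      · refine AEStronglyMeasurable.mul ?_ (memLp f).1
        exact Continuous.aestronglyMeasurable (by fun_prop)
      · refine (withDensity_absolutelyContinuous _ _).ae_le ?_
        filter_upwards [ae_restrict_mem measurableSet_ball] with z hz
        have hz' : ‖z‖ ≤ 1 := by simpa using (mem_ball_zero_iff.1 hz).le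
        simp only [map_pow, norm_mul, norm_pow, RCLike.norm_conj]
        exact mul_le_of_le_one_left (norm_nonneg _) (pow_le_one₀ (norm_nonneg _) hz')
    rw [iota, integrable_withDensity_iff_integrable_smul' (measurable_density _) (by simp)] at hI
    refine hI.congr ?_
    filter_upwards [ae_restrict_mem measurableSet_ball] with z hz
    rw [ENNReal.toReal_ofReal (density_pos hν hz).le, density_eq m hz]
  rw [integral_iota _ hν]
  have e1 : ∫ z in 𝔻, ((1 - ‖z‖ ^ 2) ^ (m + 2) *
      ((((m + 2 : ℕ) : ℝ) - 1) / (Real.pi * (1 - ‖z‖ ^ 2) ^ 2))) • (conj (z ^ n) * f z)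
      = ∫ z in 𝔻, G z := by
    refine setIntegral_congr_fun measurableSet_ball fun z hz => ?_
    simp only [hG, hρ]
    rw [density_eq m hz]
  rw [e1, ← integral_indicator measurableSet_ball, ← Complex.integral_comp_polarCoord_symm]
  have hsymm : ∀ p : ℝ × ℝ, (Complex.polarCoord.symm p : ℂ) = p.1 * exp (p.2 * I) := fun p => by
    rw [Complex.polarCoord_symm_apply, exp_mul_I]
    push_cast
    rfl
  set S : Set (ℝ × ℝ) := Set.Ioo 0 1 ×ˢ Set.Ioo (-Real.pi) Real.pi with hS
  have hSm : MeasurableSet S := measurableSet_Ioo.prod measurableSet_Ioo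
  have hST : S ⊆ polarCoord.target := by
    rintro ⟨r, θ⟩ ⟨hr, hθ⟩
    exact ⟨hr.1, hθ⟩
  have e2 : ∀ p ∈ polarCoord.target, p.1 • (𝔻.indicator G) (Complex.polarCoord.symm p) =
      S.indicator (fun p : ℝ × ℝ => p.1 • G (p.1 * exp (p.2 * I))) p := by
    rintro ⟨r, θ⟩ ⟨hr, hθ⟩
    have hr' : 0 < r := hr
    rw [hsymm]
    by_cases h1 : r < 1
    · rw [Set.indicator_of_mem ((mem_disc_polar hr' θ).2 h1), Set.indicator_of_mem]
      exact ⟨⟨hr', h1⟩, hθ⟩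
    · rw [Set.indicator_of_notMem (fun h => h1 ((mem_disc_polar hr' θ).1 h)),
        Set.indicator_of_notMem (fun h => h1 h.1.2), smul_zero]
  have hTm : MeasurableSet polarCoord.target := polarCoord.open_target.measurableSet
  rw [setIntegral_congr_fun hTm e2, setIntegral_indicator hSm, Set.inter_eq_right.2 hST]
  have hcont : ContinuousOn (fun p : ℝ × ℝ => p.1 • G (p.1 * exp (p.2 * I))) S := by
    refine ContinuousOn.smul continuousOn_fst (hGc.comp (by fun_prop) ?_)
    rintro ⟨r, θ⟩ ⟨hr, hθ⟩
    exact (mem_disc_polar hr.1 θ).2 hr.2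
  have hintS : IntegrableOn (fun p : ℝ × ℝ => p.1 • G (p.1 * exp (p.2 * I))) S := by
    refine ⟨hcont.aestronglyMeasurable hSm, ?_⟩
    have hlt : ∫⁻ z, 𝔻.indicator (fun z => ‖G z‖ₑ) z < ⊤ := by
      rw [lintegral_indicator measurableSet_ball]
      exact hint.2
    rw [← Complex.lintegral_comp_polarCoord_symm] at hlt
    refine lt_of_le_of_lt ?_ hlt
    refine le_trans ?_ (lintegral_mono_set hST)
    refine setLIntegral_mono' hSm ?_
    rintro ⟨r, θ⟩ ⟨hr, hθ⟩
    rw [hsymm, Set.indicator_of_mem ((mem_disc_polar hr.1 θ).2 hr.2), enorm_smul]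
    simp only [smul_eq_mul]
    rw [Real.enorm_eq_ofReal hr.1.le]
  rw [hS] at hintS ⊢
  rw [Measure.volume_eq_prod] at hintS ⊢
  rw [setIntegral_prod _ hintS]
  have e3 : ∀ r ∈ Set.Ioo (0 : ℝ) 1, ∫ θ in Set.Ioo (-Real.pi) Real.pi,
      r • G (r * exp (θ * I)) =
      ((2 * (m + 1) * r ^ (2 * n + 1) * (1 - r ^ 2) ^ m : ℝ) : ℂ) * coeff f n := by
    intro r hr
    have hn : ∀ θ : ℝ, ‖(r * exp (θ * I) : ℂ)‖ = r := fun θ => by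
      simp [abs_of_pos hr.1, Complex.norm_exp_ofReal_mul_I]
    simp only [hG, hn]
    simp_rw [integral_smul]
    rw [angular f n hr.1 hr.2]
    simp only [hρ, real_smul]
    have := Real.pi_pos.ne'
    have hpi : (Real.pi : ℂ) ≠ 0 := by exact_mod_cast this
    push_cast
    field_simp
    ring
  rw [setIntegral_congr_fun measurableSet_Ioo e3, integral_mul_const, integral_complex_ofReal,
    ← integral_Ioc_eq_integral_Ioo, ← intervalIntegral.integral_of_le zero_le_one, integral_beta]
  push_cast
  rfl

end Coefficients

section Basis

variable {ν : ℕ}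

/-- The monomial `z ^ n` as an element of `𝓗_ν`. -/
def monomial (ν : ℕ) [h : Fact (1 < ν)] (n : ℕ) : Bergman ν :=
  ⟨𝔻.indicator fun z => z ^ n,
    (differentiableOn_pow n).congr fun _ hz => Set.indicator_of_mem hz _,
    fun _ hz => Set.indicator_of_notMem hz _, by
      have := isFiniteMeasure_iota h.out
      refine MemLp.of_bound (C := 1) ?_ ?_
      · exact ((continuous_pow n).stronglyMeasurable.indicator
          measurableSet_ball).aestronglyMeasurable
      · refine Filter.Eventually.of_forall fun z => ?_
        by_cases hz : z ∈ 𝔻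
        · rw [Set.indicator_of_mem hz, norm_pow]
          exact pow_le_one₀ (norm_nonneg _) (mem_ball_zero_iff.1 hz).le
        · rw [Set.indicator_of_notMem hz]
          simp⟩

theorem monomial_apply (ν : ℕ) [Fact (1 < ν)] (n : ℕ) {z : ℂ} (hz : z ∈ 𝔻) :
    monomial ν n z = z ^ n := Set.indicator_of_mem hz _

theorem iteratedDeriv_monomial (ν : ℕ) [Fact (1 < ν)] (n j : ℕ) {z : ℂ} (hz : z ∈ 𝔻) :
    iteratedDeriv j (monomial ν n) z = n.descFactorial j * z ^ (n - j) := by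
  have h : (monomial ν n : ℂ → ℂ) =ᶠ[nhds z] fun z => z ^ n := by
    filter_upwards [isOpen_ball.mem_nhds hz] with w hw
    exact monomial_apply ν n hw
  rw [h.iteratedDeriv_eq, iteratedDeriv_eq_iterate, iter_deriv_pow]
  rw [Nat.descFactorial_eq_prod_range]
  push_cast
  congr 1
  by_cases hj : j ≤ n
  · refine Finset.prod_congr rfl fun i hi => ?_
    rw [Nat.cast_sub]
    have := Finset.mem_range.1 hi
    omega
  · push Not at hj
    rw [Finset.prod_eq_zero (Finset.mem_range.2 hj) (by simp),
      Finset.prod_eq_zero (Finset.mem_range.2 hj) (by simp)]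

theorem coeff_monomial (ν : ℕ) [Fact (1 < ν)] (n j : ℕ) :
    coeff (monomial ν n) j = if n = j then 1 else 0 := by
  rw [coeff, iteratedDeriv_monomial ν n j (by simp)]
  have hf : ((j.factorial : ℕ) : ℂ) ≠ 0 := by exact_mod_cast j.factorial_ne_zero
  rcases lt_trichotomy n j with h | h | h
  · rw [Nat.descFactorial_eq_zero_iff_lt.2 h, if_neg h.ne]
    simp
  · subst h
    simp [Nat.descFactorial_self, hf]
  · rw [if_neg h.ne', zero_pow (by omega)]
    simp

/-- The weight `(ν)_n / n!`, the inverse of the squared norm of `z ^ n`. -/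
def wt (ν n : ℕ) : ℝ := (ν.ascFactorial n : ℝ) / n.factorial

theorem wt_pos (ν : ℕ) [h : Fact (1 < ν)] (n : ℕ) : 0 < wt ν n := by
  have : 0 < ν.ascFactorial n := by
    obtain ⟨m, rfl⟩ : ∃ m, ν = m + 1 := ⟨ν - 1, by have := h.out; omega⟩
    exact Nat.ascFactorial_pos _ _
  have h2 := n.factorial_pos
  unfold wt
  positivity

theorem wt_succ (ν n : ℕ) : (n + 1) * wt ν (n + 1) = (ν + n) * wt ν n := by
  have h2 : (n.factorial : ℝ) ≠ 0 := by exact_mod_cast n.factorial_ne_zero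
  have h3 : (n : ℝ) + 1 ≠ 0 := by positivity
  rw [wt, wt, Nat.ascFactorial_succ, Nat.factorial_succ]
  push_cast
  field_simp

theorem inner_monomial [h : Fact (1 < ν)] (n : ℕ) (f : Bergman ν) :
    ⟪monomial ν n, f⟫_ℂ = ((wt ν n)⁻¹ : ℝ) * coeff f n := by
  have e : ∫ z, conj (monomial ν n z) * f z ∂iota ν = ∫ z, conj (z ^ n) * f z ∂iota ν := by
    refine integral_congr_ae (Filter.Eventually.of_forall fun z => ?_)
    by_cases hz : z ∈ 𝔻
    · simp only [monomial_apply ν n hz]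
    · simp only [eq_zero_of_notMem f hz, mul_zero]
  rw [inner_def, e, integral_monomial_mul h.out, wt]
  push_cast
  rw [inv_div]

/-- The normalized monomials. -/
def e (ν : ℕ) [Fact (1 < ν)] (n : ℕ) : Bergman ν := ((Real.sqrt (wt ν n) : ℝ) : ℂ) • monomial ν n

theorem inner_e [h : Fact (1 < ν)] (n : ℕ) (f : Bergman ν) :
    ⟪e ν n, f⟫_ℂ = ((Real.sqrt (wt ν n))⁻¹ : ℝ) * coeff f n := by
  rw [e, inner_smul_left, inner_monomial, ← mul_assoc, conj_ofReal, ← ofReal_mul]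
  congr 2
  have h1 := wt_pos ν n
  have h2 := Real.sqrt_pos.2 h1
  field_simp
  rw [Real.sq_sqrt h1.le]

theorem orthonormal_e (ν : ℕ) [h : Fact (1 < ν)] : Orthonormal ℂ (e ν) := by
  rw [orthonormal_iff_ite]
  intro i j
  rw [inner_e]
  have h1 : coeff (e ν j) i = (Real.sqrt (wt ν j) : ℂ) * coeff (monomial ν j) i := by
    have h0 : (e ν j : ℂ → ℂ) =ᶠ[nhds 0] (fun z => (Real.sqrt (wt ν j) : ℂ) * z ^ j) := by
      filter_upwards [isOpen_ball.mem_nhds (mem_ball_self one_pos)] with w hw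
      simp only [e, coe_smul, Pi.smul_apply, smul_eq_mul, monomial_apply ν j hw]
    have h0' : (monomial ν j : ℂ → ℂ) =ᶠ[nhds 0] (fun z => z ^ j) := by
      filter_upwards [isOpen_ball.mem_nhds (mem_ball_self one_pos)] with w hw
      exact monomial_apply ν j hw
    rw [coeff, coeff, h0.iteratedDeriv_eq, h0'.iteratedDeriv_eq, iteratedDeriv_const_mul_field,
      mul_div_assoc]
  rw [h1, coeff_monomial]
  have h2 := (Real.sqrt_pos.2 (wt_pos ν i)).ne'
  have h3 : ((Real.sqrt (wt ν i) : ℝ) : ℂ) ≠ 0 := by exact_mod_cast h2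
  by_cases hij : i = j
  · subst hij
    simp [h3]
  · rw [if_neg hij, if_neg (fun h => hij h.symm)]
    simp

theorem hasSum_coeff (f : Bergman ν) {z : ℂ} (hz : z ∈ 𝔻) :
    HasSum (fun n => coeff f n * z ^ n) (f z) := by
  have h := hasSum_taylorSeries_on_ball (diffOn f) hz
  have h2 : (fun n => coeff f n * z ^ n) =
      fun n : ℕ => (n.factorial : ℂ)⁻¹ • (z - 0) ^ n • iteratedDeriv n f 0 := by
    funext n
    simp only [coeff, smul_eq_mul, sub_zero]
    ring
  rw [h2]
  exact h

theorem wt_eq_choose (m n : ℕ) : wt (m + 1) n = ((n + m).choose m : ℝ) := by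
  have h2 : (n.factorial : ℝ) ≠ 0 := by exact_mod_cast n.factorial_ne_zero
  rw [wt, Nat.ascFactorial_eq_factorial_mul_choose, add_comm m n, Nat.choose_symm_add]
  push_cast
  field_simp

theorem one_le_wt (ν : ℕ) [h : Fact (1 < ν)] (n : ℕ) : 1 ≤ wt ν n := by
  obtain ⟨m, rfl⟩ : ∃ m, ν = m + 1 := ⟨ν - 1, by have := h.out; omega⟩
  rw [wt_eq_choose]
  exact_mod_cast Nat.choose_pos (by omega)

theorem summable_wt (ν : ℕ) [h : Fact (1 < ν)] {r : ℝ} (h0 : 0 ≤ r) (h1 : r < 1) :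
    Summable fun n => wt ν n * r ^ n := by
  obtain ⟨m, rfl⟩ : ∃ m, ν = m + 1 := ⟨ν - 1, by have := h.out; omega⟩
  simp_rw [wt_eq_choose]
  exact summable_choose_mul_geometric_of_norm_lt_one m (by rwa [Real.norm_of_nonneg h0])

theorem norm_coeff_le [h : Fact (1 < ν)] (f : Bergman ν) (n : ℕ) :
    ‖coeff f n‖ ≤ wt ν n * ‖f‖ := by
  have h1 := inner_e n f
  have h2 : ‖⟪e ν n, f⟫_ℂ‖ ≤ ‖f‖ := by
    have := norm_inner_le_norm (𝕜 := ℂ) (e ν n) f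
    rwa [(orthonormal_e ν).1 n, one_mul] at this
  have h3 := Real.sqrt_pos.2 (wt_pos ν n)
  rw [h1, norm_mul, Complex.norm_real, Real.norm_of_nonneg (by positivity),
    inv_mul_le_iff₀ h3] at h2
  refine h2.trans (mul_le_mul_of_nonneg_right ?_ (norm_nonneg _))
  rw [Real.sqrt_le_left (wt_pos ν n).le]
  nlinarith [one_le_wt ν n]

/-- Point evaluations are bounded, uniformly on smaller discs. -/
theorem exists_bound (ν : ℕ) [Fact (1 < ν)] {r : ℝ} (h0 : 0 ≤ r) (h1 : r < 1) :
    ∃ K : ℝ, 0 ≤ K ∧ ∀ (f : Bergman ν) (z : ℂ), ‖z‖ ≤ r → ‖f z‖ ≤ K * ‖f‖ := by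
  refine ⟨∑' n, wt ν n * r ^ n, tsum_nonneg fun n => ?_, fun f z hz => ?_⟩
  · have := wt_pos ν n
    positivity
  have hs := summable_wt ν h0 h1
  have hzd : z ∈ 𝔻 := mem_ball_zero_iff.2 (hz.trans_lt h1)
  rw [← (hasSum_coeff f hzd).tsum_eq, ← tsum_mul_right]
  refine tsum_of_norm_bounded (hs.mul_right ‖f‖).hasSum fun n => ?_
  rw [norm_mul, norm_pow]
  calc ‖coeff f n‖ * ‖z‖ ^ n ≤ (wt ν n * ‖f‖) * r ^ n := by
        have := wt_pos ν n
        gcongr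
        exact norm_coeff_le f n
    _ = _ := by ring

/-- The inclusion of `𝓗_ν` in `L²(dι_ν)`. -/
def toL2 (ν : ℕ) [Fact (1 < ν)] : Bergman ν →ₗᵢ[ℂ] Lp ℂ 2 (iota ν) where
  toFun f := (memLp f).toLp f
  map_add' f g := MemLp.toLp_add (memLp f) (memLp g)
  map_smul' c f := MemLp.toLp_const_smul c (memLp f)
  norm_map' f := by
    have h : ⟪(memLp f).toLp f, (memLp f).toLp f⟫_ℂ = ⟪f, f⟫_ℂ := by
      rw [L2.inner_def, inner_def]
      refine integral_congr_ae ?_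
      filter_upwards [(memLp f).coeFn_toLp] with z hz
      rw [hz, RCLike.inner_apply, mul_comm]
    rw [inner_self_eq_norm_sq_to_K, inner_self_eq_norm_sq_to_K] at h
    have h' : ‖(memLp f).toLp f‖ ^ 2 = ‖f‖ ^ 2 := by exact_mod_cast h
    exact (pow_left_inj₀ (norm_nonneg _) (norm_nonneg _) two_ne_zero).1 h'

theorem toL2_coeFn [Fact (1 < ν)] (f : Bergman ν) : toL2 ν f =ᵐ[iota ν] f :=
  (memLp f).coeFn_toLp

theorem isClosed_range_toL2 (ν : ℕ) [h : Fact (1 < ν)] : IsClosed (Set.range (toL2 ν)) := by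
  refine isClosed_of_closure_subset fun F hF => ?_
  obtain ⟨u, hu, hlim⟩ := mem_closure_iff_seq_limit.1 hF
  choose f hf using hu
  have hcau : CauchySeq f := by
    have : CauchySeq (fun n => toL2 ν (f n)) := by
      simp_rw [hf]
      exact hlim.cauchySeq
    refine (toL2 ν).isometry.isUniformInducing.cauchy_map_iff.1 ?_
    rw [Filter.map_map]
    exact this
  have hunif : ∀ r : ℝ, 0 ≤ r → r < 1 →
      UniformCauchySeqOn (fun n => (f n : ℂ → ℂ)) Filter.atTop (closedBall 0 r) := by
    intro r h0 h1
    obtain ⟨K, hK, hb⟩ := exists_bound ν h0 h1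
    rw [Metric.uniformCauchySeqOn_iff]
    intro ε hε
    obtain ⟨N, hN⟩ := Metric.cauchySeq_iff.1 hcau (ε / (K + 1)) (by positivity)
    refine ⟨N, fun m hm n hn z hz => ?_⟩
    have hz' : ‖z‖ ≤ r := by simpa using hz
    have h2 := hb (f m - f n) z hz'
    have h3 := hN m hm n hn
    rw [dist_eq_norm] at h3 ⊢
    rw [coe_sub, Pi.sub_apply] at h2
    rw [lt_div_iff₀ (by positivity)] at h3
    nlinarith [norm_nonneg (f m - f n)]
  have hpt : ∀ z : ℂ, ∃ w, Filter.Tendsto (fun n => f n z) Filter.atTop (nhds w) := by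
    intro z
    by_cases hz : z ∈ 𝔻
    · exact cauchySeq_tendsto_of_complete
        ((hunif ‖z‖ (norm_nonneg z) (mem_ball_zero_iff.1 hz)).cauchySeq (by simp))
    · exact ⟨0, by simp [eq_zero_of_notMem _ hz]⟩
  choose g hg using hpt
  have hloc : TendstoLocallyUniformlyOn (fun n => (f n : ℂ → ℂ)) g Filter.atTop 𝔻 := by
    refine tendstoLocallyUniformlyOn_iff_forall_isCompact isOpen_ball |>.2 fun K hKs hK => ?_
    obtain ⟨r, hr1, hr⟩ : ∃ r < 1, K ⊆ closedBall (0 : ℂ) r := by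
      rcases K.eq_empty_or_nonempty with rfl | hne
      · exact ⟨0, one_pos, by simp⟩
      · obtain ⟨z, hz, hmax⟩ := hK.exists_isMaxOn hne continuous_norm.continuousOn
        exact ⟨‖z‖, mem_ball_zero_iff.1 (hKs hz), fun w hw => by simpa using hmax hw⟩
    refine TendstoUniformlyOn.mono ?_ (hr.trans (closedBall_subset_closedBall (le_max_left r 0)))
    exact (hunif _ (le_max_right r 0) (max_lt hr1 one_pos)).tendstoUniformlyOn_of_tendsto
      fun z _ => hg z
  have hgd : DifferentiableOn ℂ g 𝔻 :=
    hloc.differentiableOn (Filter.Eventually.of_forall fun n => diffOn (f n)) isOpen_ball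
  have hg0 : ∀ z, z ∉ 𝔻 → g z = 0 := fun z hz =>
    tendsto_nhds_unique (hg z) (by simp [eq_zero_of_notMem _ hz])
  have hae : F =ᵐ[iota ν] g := by
    obtain ⟨ns, hns, hsub⟩ := (tendstoInMeasure_of_tendsto_Lp hlim).exists_seq_tendsto_ae
    have hall : ∀ᵐ z ∂iota ν, ∀ n, (u n : ℂ → ℂ) z = f n z := by
      rw [ae_all_iff]
      intro n
      rw [← hf n]
      exact toL2_coeFn (f n)
    filter_upwards [hsub, hall] with z hz1 hz2
    simp_rw [hz2] at hz1
    exact tendsto_nhds_unique hz1 ((hg z).comp hns.tendsto_atTop)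
  have hgL : MemLp g 2 (iota ν) := (Lp.memLp F).ae_eq hae
  refine ⟨(⟨g, hgd, hg0, hgL⟩ : holL2 ν), ?_⟩
  refine Lp.ext ?_
  exact (MemLp.coeFn_toLp hgL).trans hae.symm

instance (ν : ℕ) [Fact (1 < ν)] : CompleteSpace (Bergman ν) :=
  (completeSpace_iff_isComplete_range (toL2 ν).isometry.isUniformInducing).2
    (isClosed_range_toL2 ν).isComplete

/-- The orthonormal basis of normalized monomials. -/
def basis (ν : ℕ) [Fact (1 < ν)] : HilbertBasis ℕ ℂ (Bergman ν) :=
  HilbertBasis.mkOfOrthogonalEqBot (orthonormal_e ν) <| by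
    rw [Submodule.eq_bot_iff]
    intro f hf
    have h : ∀ n, coeff f n = 0 := fun n => by
      have h1 : ⟪e ν n, f⟫_ℂ = 0 := hf _ (Submodule.subset_span ⟨n, rfl⟩)
      rw [inner_e] at h1
      have h2 := (Real.sqrt_pos.2 (wt_pos ν n)).ne'
      rcases mul_eq_zero.1 h1 with h3 | h3
      · exact absurd (by exact_mod_cast h3) (inv_ne_zero h2)
      · exact h3
    refine DFunLike.ext _ _ fun z => ?_
    by_cases hz : z ∈ 𝔻
    · have := hasSum_coeff f hz
      simp_rw [h, zero_mul] at this
      exact this.unique hasSum_zero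
    · exact eq_zero_of_notMem f hz

theorem basis_apply (ν : ℕ) [Fact (1 < ν)] (n : ℕ) : basis ν n = e ν n :=
  congrFun (HilbertBasis.coe_mkOfOrthogonalEqBot (orthonormal_e ν) _) n

end Basis

section Combinatorics

/-- The constant `C_{μ,ν,k}`, the inverse of the norm of `(z - w) ^ k` in `𝓗_μ ⊗ 𝓗_ν`; it is given by
`C_{μ,ν,k}⁻² = k! (μ + ν + k - 1)_k / ((μ)_k (ν)_k)`. -/
def cst (μ ν k : ℕ) : ℝ :=
  Real.sqrt ((μ.ascFactorial k * ν.ascFactorial k : ℝ) /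
    (k.factorial * (μ + ν + k - 1).ascFactorial k))

/-- The `j`-th coefficient of the transvectant. -/
def tcoef (μ ν k j : ℕ) : ℝ :=
  (-1) ^ j * k.choose j / (μ.ascFactorial j * ν.ascFactorial (k - j))

/-- The value at `1` of the transvectant of `z ^ a` and `z ^ b`. -/
def tau (μ ν k a b : ℕ) : ℝ :=
  ∑ j ∈ Finset.range (k + 1), tcoef μ ν k j * (a.descFactorial j * b.descFactorial (k - j))

theorem desc_lower (a j : ℕ) :
    (a : ℝ) * (a - 1).descFactorial j = (a - j) * a.descFactorial j := by
  rcases a with _ | a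
  · rcases j with _ | j <;> simp
  · have h := Nat.succ_descFactorial a j
    by_cases hj : j ≤ a + 1
    · have h2 : (((a + 1 - j : ℕ) * (a + 1).descFactorial j : ℕ) : ℝ) =
        ((a + 1) * a.descFactorial j : ℕ) := by exact_mod_cast h
      push_cast [Nat.cast_sub hj] at h2
      simp only [Nat.add_sub_cancel]
      push_cast
      linarith
    · have h1 : (a + 1).descFactorial j = 0 := Nat.descFactorial_eq_zero_iff_lt.2 (by omega)
      have h2 : a.descFactorial j = 0 := Nat.descFactorial_eq_zero_iff_lt.2 (by omega)
      simp [h1, h2]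

theorem desc_succ (a j : ℕ) :
    (a.descFactorial (j + 1) : ℝ) = (a - j) * a.descFactorial j := by
  rw [Nat.descFactorial_succ]
  by_cases hj : j ≤ a
  · push_cast [Nat.cast_sub hj]
    rfl
  · have h2 : a.descFactorial j = 0 := Nat.descFactorial_eq_zero_iff_lt.2 (by omega)
    simp [h2]

theorem desc_raise (μ a j : ℕ) :
    ((a : ℝ) + μ) * (a + 1).descFactorial j =
      (a + μ + j) * a.descFactorial j + j * (μ + j - 1) * a.descFactorial (j - 1) := by
  rcases j with _ | j
  · simp
  · rw [Nat.succ_descFactorial_succ, desc_succ, Nat.add_sub_cancel]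
    push_cast
    ring

theorem tau_lower (μ ν k a b : ℕ) :
    (a : ℝ) * tau μ ν k (a - 1) b + b * tau μ ν k a (b - 1) =
      ((a : ℝ) + b - k) * tau μ ν k a b := by
  simp only [tau, Finset.mul_sum, ← Finset.sum_add_distrib]
  refine Finset.sum_congr rfl fun j hj => ?_
  have hj' : j ≤ k := by have := Finset.mem_range.1 hj; omega
  have h1 := desc_lower a j
  have h2 := desc_lower b (k - j)
  rw [Nat.cast_sub hj'] at h2
  linear_combination tcoef μ ν k j * b.descFactorial (k - j) * h1 +
    tcoef μ ν k j * a.descFactorial j * h2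

theorem asc_pos (μ : ℕ) [h : Fact (1 < μ)] (j : ℕ) : (0 : ℝ) < μ.ascFactorial j := by
  obtain ⟨m, rfl⟩ : ∃ m, μ = m + 1 := ⟨μ - 1, by have := h.out; omega⟩
  exact_mod_cast Nat.ascFactorial_pos _ _

theorem tcoef_succ (μ ν k j : ℕ) [Fact (1 < μ)] [Fact (1 < ν)] (hj : j < k) :
    tcoef μ ν k (j + 1) * ((j + 1) * (μ + j)) =
      -(tcoef μ ν k j * ((k - j : ℕ) * (ν + (k - j : ℕ) - 1))) := by
  obtain ⟨i, rfl⟩ : ∃ i, k = j + 1 + i := ⟨k - (j + 1), by omega⟩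
  have e1 : j + 1 + i - (j + 1) = i := by omega
  have e2 : j + 1 + i - j = i + 1 := by omega
  rw [tcoef, tcoef, e1, e2, Nat.ascFactorial_succ, Nat.ascFactorial_succ]
  have h1 := (asc_pos μ j).ne'
  have h2 := (asc_pos ν i).ne'
  have h3 : (μ : ℝ) + j ≠ 0 := by
    have : (1 : ℝ) < μ := by exact_mod_cast (Fact.out : 1 < μ)
    positivity
  have h4 : (ν : ℝ) + i ≠ 0 := by
    have : (1 : ℝ) < ν := by exact_mod_cast (Fact.out : 1 < ν)
    positivity
  have h5 : (((j + 1 + i).choose (j + 1) : ℕ) : ℝ) * (j + 1) = (j + 1 + i).choose j * (i + 1) := by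
    have := Nat.choose_succ_right_eq (j + 1 + i) j
    rw [e2] at this
    exact_mod_cast this
  push_cast
  rw [show (ν : ℝ) + (i + 1) - 1 = ν + i by ring]
  field_simp
  rw [pow_succ]
  linear_combination (-1) ^ j * (-1) * h5

theorem tau_raise (μ ν k a b : ℕ) [Fact (1 < μ)] [Fact (1 < ν)] :
    ((a : ℝ) + μ) * tau μ ν k (a + 1) b + (b + ν) * tau μ ν k a (b + 1) =
      ((a : ℝ) + b + μ + ν + k) * tau μ ν k a b := by
  set q : ℕ → ℝ := fun j => tcoef μ ν k j *
    (j * (μ + j - 1) * a.descFactorial (j - 1) * b.descFactorial (k - j)) with hq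
  set s : ℕ → ℝ := fun j => tcoef μ ν k j *
    ((k - j : ℕ) * (ν + (k - j : ℕ) - 1) * a.descFactorial j * b.descFactorial (k - j - 1)) with hs
  have h0 : ((a : ℝ) + μ) * tau μ ν k (a + 1) b + (b + ν) * tau μ ν k a (b + 1) =
      ((a : ℝ) + b + μ + ν + k) * tau μ ν k a b +
        ∑ j ∈ Finset.range (k + 1), (q j + s j) := by
    simp only [tau, Finset.mul_sum, ← Finset.sum_add_distrib]
    refine Finset.sum_congr rfl fun j hj => ?_
    have hj' : j ≤ k := by have := Finset.mem_range.1 hj; omega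
    have h1 := desc_raise μ a j
    have h2 := desc_raise ν b (k - j)
    simp only [hq, hs]
    rw [Nat.cast_sub hj'] at h2 ⊢
    linear_combination tcoef μ ν k j * b.descFactorial (k - j) * h1 +
      tcoef μ ν k j * a.descFactorial j * h2
  have h1 : ∑ j ∈ Finset.range (k + 1), (q j + s j) = 0 := by
    rw [Finset.sum_add_distrib, Finset.sum_range_succ', Finset.sum_range_succ s]
    have hq0 : q 0 = 0 := by simp [hq]
    have hsk : s k = 0 := by simp [hs]
    rw [hq0, hsk, add_zero, add_zero, ← Finset.sum_add_distrib]
    refine Finset.sum_eq_zero fun j hj => ?_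
    have := tcoef_succ μ ν k j (Finset.mem_range.1 hj)
    simp only [hq, hs]
    rw [Nat.add_sub_cancel, show k - (j + 1) = k - j - 1 by omega]
    push_cast
    linear_combination a.descFactorial j * b.descFactorial (k - j - 1) * this
  rw [h0, h1, add_zero]

/-- The squared norm of the `n`-th vector before normalization. -/
def nrm (μ ν k n : ℕ) : ℝ :=
  ∑ p ∈ Finset.HasAntidiagonal.antidiagonal (n + k), tau μ ν k p.1 p.2 ^ 2 * (wt μ p.1 * wt ν p.2)

theorem nrm_succ (μ ν k n : ℕ) [Fact (1 < μ)] [Fact (1 < ν)] :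
    (n + 1) * nrm μ ν k (n + 1) = ((μ + ν + 2 * k : ℕ) + n) * nrm μ ν k n := by
  have h1 : (n + 1) * nrm μ ν k (n + 1) =
      ∑ p ∈ Finset.HasAntidiagonal.antidiagonal (n + k + 1),
        (p.1 * tau μ ν k (p.1 - 1) p.2 * tau μ ν k p.1 p.2 * (wt μ p.1 * wt ν p.2) +
        p.2 * tau μ ν k p.1 (p.2 - 1) * tau μ ν k p.1 p.2 * (wt μ p.1 * wt ν p.2)) := by
    rw [nrm, Finset.mul_sum, show n + 1 + k = n + k + 1 by omega]
    refine Finset.sum_congr rfl fun p hp => ?_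
    have h := tau_lower μ ν k p.1 p.2
    have hp' : (p.1 : ℝ) + p.2 = n + k + 1 := by exact_mod_cast Finset.HasAntidiagonal.mem_antidiagonal.1 hp
    rw [hp'] at h
    linear_combination -(tau μ ν k p.1 p.2 * (wt μ p.1 * wt ν p.2)) * h
  rw [h1, Finset.sum_add_distrib, Finset.Nat.sum_antidiagonal_succ,
    Finset.Nat.sum_antidiagonal_succ', nrm, Finset.mul_sum]
  simp only [Nat.cast_zero, zero_mul, zero_add, Nat.add_sub_cancel]
  rw [← Finset.sum_add_distrib]
  refine Finset.sum_congr rfl fun p hp => ?_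
  have h := tau_raise μ ν k p.1 p.2
  have hp' : (p.1 : ℝ) + p.2 = n + k := by exact_mod_cast Finset.HasAntidiagonal.mem_antidiagonal.1 hp
  rw [hp'] at h
  have w1 := wt_succ μ p.1
  have w2 := wt_succ ν p.2
  push_cast
  linear_combination tau μ ν k p.1 p.2 * tau μ ν k (p.1 + 1) p.2 * wt ν p.2 * w1 +
    tau μ ν k p.1 p.2 * tau μ ν k p.1 (p.2 + 1) * wt μ p.1 * w2 +
    tau μ ν k p.1 p.2 * wt μ p.1 * wt ν p.2 * h

theorem tau_diag (μ ν a b : ℕ) :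
    tau μ ν (a + b) a b = (-1) ^ a * (a + b).factorial / (μ.ascFactorial a * ν.ascFactorial b) := by
  rw [tau, Finset.sum_eq_single_of_mem a (by simp)]
  · rw [tcoef, Nat.add_sub_cancel_left, Nat.descFactorial_self, Nat.descFactorial_self]
    have : ((a + b).choose a * (a.factorial * b.factorial) : ℝ) = (a + b).factorial := by
      have := Nat.add_choose_mul_factorial_mul_factorial a b
      rw [← Nat.choose_symm_add] at this
      rw [← mul_assoc]
      exact_mod_cast this
    rw [← this]
    ring
  · intro j hj hja
    have hj' : j < a + b + 1 := Finset.mem_range.1 hj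
    rcases lt_or_gt_of_ne hja with h | h
    · rw [Nat.descFactorial_eq_zero_iff_lt.2 (show b < a + b - j by omega)]
      simp
    · rw [Nat.descFactorial_eq_zero_iff_lt.2 h]
      simp

theorem nrm_zero (μ ν k : ℕ) [hμ : Fact (1 < μ)] [hν : Fact (1 < ν)] :
    cst μ ν k ^ 2 * nrm μ ν k 0 = 1 := by
  obtain ⟨m, rfl⟩ : ∃ m, μ = m + 1 := ⟨μ - 1, by have := hμ.out; omega⟩
  obtain ⟨n, rfl⟩ : ∃ n, ν = n + 1 := ⟨ν - 1, by have := hν.out; omega⟩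
  have fr : ∀ i : ℕ, (i.factorial : ℝ) ≠ 0 := fun i => by exact_mod_cast i.factorial_ne_zero
  have asc : ∀ l i : ℕ, ((l + 1).ascFactorial i : ℝ) = (l + i).factorial / l.factorial := by
    intro l i
    rw [eq_div_iff (fr l), mul_comm]
    exact_mod_cast Nat.factorial_mul_ascFactorial l i
  have key : nrm (m + 1) (n + 1) k 0 * ((m + 1).ascFactorial k * (n + 1).ascFactorial k : ℝ) =
      k.factorial * (m + 1 + (n + 1) + k - 1).ascFactorial k := by
    have e : m + 1 + (n + 1) + k - 1 = (m + n + k) + 1 := by omega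
    rw [e, Nat.ascFactorial_eq_factorial_mul_choose (m + n + k), show m + n + k + k = (n + k) + (m + k) by ring,
      Nat.add_choose_eq, nrm, zero_add]
    push_cast
    rw [Finset.sum_mul, Finset.mul_sum, Finset.mul_sum]
    refine Finset.sum_congr rfl fun p hp => ?_
    obtain ⟨a, b⟩ := p
    have hk : a + b = k := Finset.HasAntidiagonal.mem_antidiagonal.1 hp
    subst hk
    simp only
    rw [tau_diag, wt, wt, asc, asc, asc, asc,
      Nat.cast_choose ℝ (show a ≤ n + (a + b) by omega),
      Nat.cast_choose ℝ (show b ≤ m + (a + b) by omega),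
      show n + (a + b) - a = n + b by omega, show m + (a + b) - b = m + a by omega]
    have := fr a; have := fr b; have := fr m; have := fr n; have := fr (m + a); have := fr (n + b)
    have := fr (a + b); have := fr (m + (a + b)); have := fr (n + (a + b))
    field_simp
    rw [← pow_mul, mul_comm a 2, pow_mul]
    simp
  have h1 := asc_pos (m + 1) k
  have h2 := asc_pos (n + 1) k
  have h3 : (0 : ℝ) < k.factorial * (m + 1 + (n + 1) + k - 1).ascFactorial k := by
    have e : m + 1 + (n + 1) + k - 1 = (m + n + k) + 1 := by omega
    rw [e]
    exact_mod_cast Nat.mul_pos k.factorial_pos (Nat.ascFactorial_pos _ _)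
  rw [cst, Real.sq_sqrt (by positivity), div_mul_eq_mul_div, mul_comm, key, div_self h3.ne']

theorem nrm_eq (μ ν k n : ℕ) [Fact (1 < μ)] [Fact (1 < ν)] :
    cst μ ν k ^ 2 * nrm μ ν k n = wt (μ + ν + 2 * k) n := by
  induction n with
  | zero => rw [nrm_zero]; simp [wt]
  | succ n ih =>
    have h1 := nrm_succ μ ν k n
    have h2 := wt_succ (μ + ν + 2 * k) n
    have h3 : (n : ℝ) + 1 ≠ 0 := by positivity
    apply mul_left_cancel₀ h3
    rw [h2, ← ih]
    linear_combination cst μ ν k ^ 2 * h1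

end Combinatorics

instance (μ ν k : ℕ) [h : Fact (1 < μ)] : Fact (1 < μ + ν + 2 * k) :=
  ⟨by have := h.out; omega⟩

/-- The Hilbert space tensor product: the completion of the algebraic tensor product with respect to
the inner product `⟨x ⊗ y, x' ⊗ y'⟩ = ⟨x, x'⟩ ⟨y, y'⟩`. -/
abbrev HTensor (E F : Type) [NormedAddCommGroup E] [InnerProductSpace ℂ E] [NormedAddCommGroup F]
    [InnerProductSpace ℂ F] : Type :=
  UniformSpace.Completion (E ⊗[ℂ] F)

/-- The elementary tensor `x ⊗ y` in the Hilbert space tensor product. -/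
def htmul {E F : Type} [NormedAddCommGroup E] [InnerProductSpace ℂ E] [NormedAddCommGroup F]
    [InnerProductSpace ℂ F] (x : E) (y : F) : HTensor E F :=
  ((x ⊗ₜ[ℂ] y : E ⊗[ℂ] F) : UniformSpace.Completion (E ⊗[ℂ] F))

/-- The operator `A ⊗ I_F` on the Hilbert space tensor product, the continuous extension of
`x ⊗ y ↦ A x ⊗ y`. -/
def tensorId {E : Type} (F : Type) [NormedAddCommGroup E] [InnerProductSpace ℂ E]
    [NormedAddCommGroup F] [InnerProductSpace ℂ F] (A : E →L[ℂ] E) :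
    HTensor E F →L[ℂ] HTensor E F :=
  (A.rTensor F).completion

theorem tensorId_htmul {E : Type} (F : Type) [NormedAddCommGroup E] [InnerProductSpace ℂ E]
    [NormedAddCommGroup F] [InnerProductSpace ℂ F] (A : E →L[ℂ] E) (x : E) (y : F) :
    tensorId F A (htmul x y) = htmul (A x) y :=
  ContinuousLinearMap.completion_apply_coe _ _

theorem tensorId_add {E : Type} (F : Type) [NormedAddCommGroup E] [InnerProductSpace ℂ E]
    [NormedAddCommGroup F] [InnerProductSpace ℂ F] (A B : E →L[ℂ] E) :
    tensorId F (A + B) = tensorId F A + tensorId F B := by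
  refine ContinuousLinearMap.ext fun x => ?_
  induction x using UniformSpace.Completion.induction_on with
  | hp => exact isClosed_eq (by fun_prop) (by fun_prop)
  | ih x =>
    simp [tensorId, ContinuousLinearMap.completion_apply_coe, ContinuousLinearMap.rTensor_add,
      UniformSpace.Completion.coe_add, -ContinuousLinearMap.rTensor_apply]

theorem tensorId_smul {E : Type} (F : Type) [NormedAddCommGroup E] [InnerProductSpace ℂ E]
    [NormedAddCommGroup F] [InnerProductSpace ℂ F] (c : ℂ) (A : E →L[ℂ] E) :
    tensorId F (c • A) = c • tensorId F A := by
  refine ContinuousLinearMap.ext fun x => ?_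
  induction x using UniformSpace.Completion.induction_on with
  | hp => exact isClosed_eq (tensorId F (c • A)).continuous (c • tensorId F A).continuous
  | ih x =>
    change ((c • A).rTensor F).completion (x : HTensor E F) = c • (A.rTensor F).completion x
    rw [ContinuousLinearMap.completion_apply_coe, ContinuousLinearMap.completion_apply_coe,
      ContinuousLinearMap.rTensor_smul, ← UniformSpace.Completion.coe_smul]
    rfl

section Projection

variable {μ ν k : ℕ} [Fact (1 < μ)] [Fact (1 < ν)]

theorem orthonormal_htmul (μ ν : ℕ) [Fact (1 < μ)] [Fact (1 < ν)] :
    Orthonormal ℂ fun p : ℕ × ℕ => htmul (e μ p.1) (e ν p.2) := by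
  rw [orthonormal_iff_ite]
  rintro ⟨a, b⟩ ⟨a', b'⟩
  simp only [htmul, UniformSpace.Completion.inner_coe, TensorProduct.inner_tmul]
  rw [orthonormal_iff_ite.1 (orthonormal_e μ), orthonormal_iff_ite.1 (orthonormal_e ν)]
  by_cases h1 : a = a' <;> by_cases h2 : b = b' <;> simp [h1, h2]

/-- Coefficients of the embedding of `𝓗_{μ+ν+2k}` in `𝓗_μ ⊗ 𝓗_ν`. -/
def cf (μ ν k n : ℕ) (p : ℕ × ℕ) : ℝ :=
  cst μ ν k * tau μ ν k p.1 p.2 * Real.sqrt (wt μ p.1 * wt ν p.2 / wt (μ + ν + 2 * k) n)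

/-- Images of the normalized monomials in `𝓗_μ ⊗ 𝓗_ν`. -/
def vec (μ ν k : ℕ) [Fact (1 < μ)] [Fact (1 < ν)] (n : ℕ) : HTensor (Bergman μ) (Bergman ν) :=
  ∑ p ∈ Finset.HasAntidiagonal.antidiagonal (n + k), (cf μ ν k n p : ℂ) • htmul (e μ p.1) (e ν p.2)

theorem inner_vec_htmul (n : ℕ) (p : ℕ × ℕ) :
    ⟪vec μ ν k n, htmul (e μ p.1) (e ν p.2)⟫_ℂ = if p.1 + p.2 = n + k then (cf μ ν k n p : ℂ) else 0 := by
  have h := orthonormal_iff_ite.1 (orthonormal_htmul μ ν)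
  rw [vec, sum_inner]
  simp only [inner_smul_left, h, conj_ofReal, mul_ite, mul_one, mul_zero]
  rw [Finset.sum_ite_eq']
  simp [Finset.HasAntidiagonal.mem_antidiagonal]

theorem orthonormal_vec (μ ν k : ℕ) [Fact (1 < μ)] [Fact (1 < ν)] : Orthonormal ℂ (vec μ ν k) := by
  rw [orthonormal_iff_ite]
  intro m n
  have h0 : ⟪vec μ ν k m, vec μ ν k n⟫_ℂ = ∑ p ∈ Finset.HasAntidiagonal.antidiagonal (n + k),
      (cf μ ν k n p : ℂ) * if p.1 + p.2 = m + k then (cf μ ν k m p : ℂ) else 0 := by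
    conv_lhs => rw [vec.eq_1 μ ν k n, inner_sum]
    refine Finset.sum_congr rfl fun p _ => ?_
    rw [inner_smul_right, inner_vec_htmul]
  rw [h0]
  by_cases hmn : m = n
  · subst hmn
    rw [if_pos rfl]
    have h1 : ∀ p ∈ Finset.HasAntidiagonal.antidiagonal (m + k),
        ((cf μ ν k m p : ℂ) * if p.1 + p.2 = m + k then (cf μ ν k m p : ℂ) else 0) =
        ((cst μ ν k ^ 2 * (tau μ ν k p.1 p.2 ^ 2 * (wt μ p.1 * wt ν p.2)) /
          wt (μ + ν + 2 * k) m : ℝ) : ℂ) := by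
      intro p hp
      rw [if_pos (Finset.HasAntidiagonal.mem_antidiagonal.1 hp), ← ofReal_mul]
      congr 1
      have w1 := wt_pos μ p.1
      have w2 := wt_pos ν p.2
      have w3 := wt_pos (μ + ν + 2 * k) m
      have := Real.mul_self_sqrt (show 0 ≤ wt μ p.1 * wt ν p.2 / wt (μ + ν + 2 * k) m by positivity)
      rw [cf]
      linear_combination (cst μ ν k * tau μ ν k p.1 p.2) ^ 2 * this
    rw [Finset.sum_congr rfl h1, ← ofReal_sum, ← Finset.sum_div, ← Finset.mul_sum]
    have := nrm_eq μ ν k m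
    rw [nrm] at this
    rw [this, div_self (wt_pos _ _).ne', ofReal_one]
  · rw [if_neg hmn]
    refine Finset.sum_eq_zero fun p hp => ?_
    have := Finset.HasAntidiagonal.mem_antidiagonal.1 hp
    rw [if_neg (by omega), mul_zero]

/-- The isometric embedding of `𝓗_{μ+ν+2k}` in `𝓗_μ ⊗ 𝓗_ν`. -/
def emb (μ ν k : ℕ) [Fact (1 < μ)] [Fact (1 < ν)] :
    Bergman (μ + ν + 2 * k) →ₗᵢ[ℂ] HTensor (Bergman μ) (Bergman ν) :=
  ((orthonormal_vec μ ν k).orthogonalFamily.linearIsometry).comp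
    (basis (μ + ν + 2 * k)).repr.toLinearIsometry

theorem emb_e (n : ℕ) : emb μ ν k (e (μ + ν + 2 * k) n) = vec μ ν k n := by
  rw [← basis_apply]
  change (orthonormal_vec μ ν k).orthogonalFamily.linearIsometry
    ((basis (μ + ν + 2 * k)).repr (basis (μ + ν + 2 * k) n)) = _
  rw [HilbertBasis.repr_self, OrthogonalFamily.linearIsometry_apply_single]
  simp

/-- Derivatives at a point of the disc are bounded functionals. -/
theorem exists_derivFunctional (ν : ℕ) [Fact (1 < ν)] (j : ℕ) {ζ : ℂ} (hζ : ζ ∈ 𝔻) :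
    ∃ D : Bergman ν →L[ℂ] ℂ, ∀ f, D f = iteratedDeriv j f ζ := by
  have hζ' : ‖ζ‖ < 1 := mem_ball_zero_iff.1 hζ
  set R := (1 - ‖ζ‖) / 2 with hR
  have hR0 : 0 < R := by rw [hR]; linarith
  have hr1 : ‖ζ‖ + R < 1 := by rw [hR]; linarith
  obtain ⟨K, hK, hb⟩ := exists_bound ν (r := ‖ζ‖ + R) (by positivity) hr1
  have hcd : ∀ f : Bergman ν, ContDiffAt ℂ j f ζ := fun f =>
    ((diffOn f).analyticAt (isOpen_ball.mem_nhds hζ)).contDiffAt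
  refine ⟨LinearMap.mkContinuous
    { toFun := fun f => iteratedDeriv j f ζ
      map_add' := fun f g => iteratedDeriv_add (hcd f) (hcd g)
      map_smul' := fun c f => by
        rw [coe_smul, iteratedDeriv_const_smul_field]
        rfl } (j.factorial * K / R ^ j) ?_, fun f => rfl⟩
  intro f
  have hsub : closedBall ζ R ⊆ 𝔻 := by
    intro z hz
    have h1 : ‖z - ζ‖ ≤ R := by simpa [dist_eq_norm] using hz
    have h2 : ‖z‖ ≤ ‖z - ζ‖ + ‖ζ‖ := by simpa using norm_add_le (z - ζ) ζ
    exact mem_ball_zero_iff.2 (by linarith)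
  have h := norm_iteratedDeriv_le_of_forall_mem_sphere_norm_le (C := K * ‖f‖) j hR0
    (((diffOn f).mono hsub).diffContOnCl_ball subset_rfl) (fun z hz => hb f z (by
      have h1 : ‖z - ζ‖ = R := by simpa [dist_eq_norm] using hz
      have h2 : ‖z‖ ≤ ‖z - ζ‖ + ‖ζ‖ := by simpa using norm_add_le (z - ζ) ζ
      linarith))
  refine h.trans (le_of_eq ?_)
  ring

theorem dense_ext {E F : Type} [NormedAddCommGroup E] [InnerProductSpace ℂ E]
    [NormedAddCommGroup F] [NormedSpace ℂ F] {ι : Type} (b : HilbertBasis ι ℂ E) {S T : E →L[ℂ] F}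
    (h : ∀ i, S (b i) = T (b i)) : S = T := by
  refine ContinuousLinearMap.ext_on (s := Set.range b) ?_ ?_
  · rw [Submodule.dense_iff_topologicalClosure_eq_top]
    exact b.dense_span
  · rintro _ ⟨i, rfl⟩
    exact h i

/-- The transvectant `C_{μ,ν,k} ∑_j (-1)^j (k choose j) / ((μ)_j (ν)_{k-j}) ∂_z^j ∂_w^{k-j} f(z) g(w)` at
`z = w = ζ`. -/
def transvectant (μ ν k : ℕ) (f g : ℂ → ℂ) (ζ : ℂ) : ℂ :=
  cst μ ν k * ∑ j ∈ Finset.range (k + 1),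
    (-1) ^ j * (k.choose j : ℂ) / (μ.ascFactorial j * ν.ascFactorial (k - j)) *
      (iteratedDeriv j f ζ * iteratedDeriv (k - j) g ζ)

theorem adjoint_emb_htmul (a b : ℕ) :
    (emb μ ν k).toContinuousLinearMap.adjoint (htmul (e μ a) (e ν b)) =
      if k ≤ a + b then (cf μ ν k (a + b - k) (a, b) : ℂ) • e (μ + ν + 2 * k) (a + b - k) else 0 := by
  apply (basis (μ + ν + 2 * k)).repr.injective
  ext n
  rw [HilbertBasis.repr_apply_apply, HilbertBasis.repr_apply_apply, basis_apply,
    ContinuousLinearMap.adjoint_inner_right, LinearIsometry.coe_toContinuousLinearMap, emb_e,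
    inner_vec_htmul n (a, b)]
  split_ifs with h1 h2 h2
  · have : a + b - k = n := by simp only at h1; omega
    rw [this, inner_smul_right, orthonormal_iff_ite.1 (orthonormal_e _), if_pos rfl, mul_one]
  · simp only at h1; omega
  · have : n ≠ a + b - k := by simp only at h1; omega
    rw [inner_smul_right, orthonormal_iff_ite.1 (orthonormal_e _), if_neg this, mul_zero]
  · simp

theorem transvectant_e (a b : ℕ) {ζ : ℂ} (hζ : ζ ∈ 𝔻) :
    transvectant μ ν k (e μ a) (e ν b) ζ =
      (emb μ ν k).toContinuousLinearMap.adjoint (htmul (e μ a) (e ν b)) ζ := by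
  have hd : ∀ (κ : ℕ) [Fact (1 < κ)] (n j : ℕ), iteratedDeriv j (e κ n) ζ =
      (Real.sqrt (wt κ n) : ℂ) * (n.descFactorial j * ζ ^ (n - j)) := by
    intro κ _ n j
    rw [e, coe_smul, iteratedDeriv_const_smul_field, iteratedDeriv_monomial κ n j hζ]
    rfl
  rw [adjoint_emb_htmul, transvectant]
  simp only [hd]
  split_ifs with h
  · have h1 : ∀ j ∈ Finset.range (k + 1),
        (-1) ^ j * (k.choose j : ℂ) / (μ.ascFactorial j * ν.ascFactorial (k - j)) *
        ((Real.sqrt (wt μ a) : ℂ) * (a.descFactorial j * ζ ^ (a - j)) *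
          ((Real.sqrt (wt ν b) : ℂ) * (b.descFactorial (k - j) * ζ ^ (b - (k - j))))) =
        ((tcoef μ ν k j * (a.descFactorial j * b.descFactorial (k - j)) : ℝ) : ℂ) *
          (Real.sqrt (wt μ a) * Real.sqrt (wt ν b) * ζ ^ (a + b - k)) := by
      intro j hj
      have hj' : j ≤ k := by have := Finset.mem_range.1 hj; omega
      rw [tcoef]
      push_cast
      by_cases ha : a < j
      · rw [Nat.descFactorial_eq_zero_iff_lt.2 ha]
        simp
      by_cases hb : b < k - j
      · rw [Nat.descFactorial_eq_zero_iff_lt.2 hb]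
        simp
      rw [show a + b - k = (a - j) + (b - (k - j)) by omega, pow_add]
      ring
    rw [Finset.sum_congr rfl h1, ← Finset.sum_mul, ← ofReal_sum]
    change _ = (cf μ ν k (a + b - k) (a, b) : ℂ) * (e (μ + ν + 2 * k) (a + b - k) ζ)
    have h2 : e (μ + ν + 2 * k) (a + b - k) ζ =
        (Real.sqrt (wt (μ + ν + 2 * k) (a + b - k)) : ℂ) * ζ ^ (a + b - k) := by
      rw [e, coe_smul, Pi.smul_apply, monomial_apply _ _ hζ, smul_eq_mul]
    rw [h2, cf, ← tau]
    have w3 := wt_pos (μ + ν + 2 * k) (a + b - k)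
    have h3 : Real.sqrt (wt μ a * wt ν b / wt (μ + ν + 2 * k) (a + b - k)) *
        Real.sqrt (wt (μ + ν + 2 * k) (a + b - k)) = Real.sqrt (wt μ a) * Real.sqrt (wt ν b) := by
      have w1 := wt_pos μ a
      have w2 := wt_pos ν b
      rw [← Real.sqrt_mul (by positivity), div_mul_cancel₀ _ w3.ne', Real.sqrt_mul w1.le]
    have h4 := congrArg (fun x : ℝ => (x : ℂ)) h3
    simp only [ofReal_mul] at h4
    simp only [ofReal_mul]
    linear_combination -(cst μ ν k * tau μ ν k a b * ζ ^ (a + b - k) : ℂ) * h4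
  · rw [Finset.sum_eq_zero, mul_zero]
    · rfl
    · intro j hj
      have hj' : j ≤ k := by have := Finset.mem_range.1 hj; omega
      by_cases ha : a < j
      · rw [Nat.descFactorial_eq_zero_iff_lt.2 ha]
        simp
      · rw [Nat.descFactorial_eq_zero_iff_lt.2 (show b < k - j by omega)]
        simp

theorem adjoint_emb_apply (f : Bergman μ) (g : Bergman ν) {ζ : ℂ} (hζ : ζ ∈ 𝔻) :
    (emb μ ν k).toContinuousLinearMap.adjoint (htmul f g) ζ = transvectant μ ν k f g ζ := by
  obtain ⟨ev, hev⟩ := exists_derivFunctional (μ + ν + 2 * k) 0 hζ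
  choose D hD using fun j => exists_derivFunctional μ j hζ
  choose D' hD' using fun j => exists_derivFunctional ν j hζ
  let B₁ : Bergman μ →L[ℂ] Bergman ν →L[ℂ] ℂ :=
    (ContinuousLinearMap.compL ℂ (Bergman ν) (Bergman μ ⊗[ℂ] Bergman ν) ℂ
      (ev.comp ((emb μ ν k).toContinuousLinearMap.adjoint.comp
        (UniformSpace.Completion.toComplL (𝕜 := ℂ))))).comp
      (TensorProduct.mkL ℂ (Bergman μ) (Bergman ν))
  have hB₁ : ∀ f g, B₁ f g = (emb μ ν k).toContinuousLinearMap.adjoint (htmul f g) ζ := by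
    intro f g
    have := hev ((emb μ ν k).toContinuousLinearMap.adjoint (htmul f g))
    rw [iteratedDeriv_zero] at this
    exact this
  let B₂ : Bergman μ →L[ℂ] Bergman ν →L[ℂ] ℂ :=
    (cst μ ν k : ℂ) • ∑ j ∈ Finset.range (k + 1),
      ((-1) ^ j * (k.choose j : ℂ) / (μ.ascFactorial j * ν.ascFactorial (k - j))) •
        (D j).smulRight (D' (k - j))
  have hB₂ : ∀ f g, B₂ f g = transvectant μ ν k f g ζ := by
    intro f g
    simp only [B₂, transvectant, _root_.smul_apply, _root_.sum_apply,
      ContinuousLinearMap.smulRight_apply, smul_eq_mul, hD, hD']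
  clear_value B₁ B₂
  have hB : B₁ = B₂ := by
    refine dense_ext (basis μ) fun a => dense_ext (basis ν) fun b => ?_
    rw [hB₁, hB₂, basis_apply, basis_apply, transvectant_e a b hζ]
  rw [← hB₁, ← hB₂, hB]

theorem exists_proj (μ ν k : ℕ) [Fact (1 < μ)] [Fact (1 < ν)] :
    ∃ P : HTensor (Bergman μ) (Bergman ν) →L[ℂ] Bergman (μ + ν + 2 * k),
      (∀ (f : Bergman μ) (g : Bergman ν), ∀ ζ ∈ 𝔻, P (htmul f g) ζ = transvectant μ ν k f g ζ) ∧
        P ∘L P.adjoint = ContinuousLinearMap.id ℂ _ := by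
  refine ⟨(emb μ ν k).toContinuousLinearMap.adjoint,
    fun f g ζ hζ => adjoint_emb_apply f g hζ, ?_⟩
  rw [ContinuousLinearMap.adjoint_adjoint]
  exact LinearIsometry.adjoint_comp_self _

end Projection

/-- The projection `P_k` of `𝓗_μ ⊗ 𝓗_ν` onto its component `𝓗_{μ+ν+2k}`: the bounded operator with
`P_k (f ⊗ g)(ζ) = C_{μ,ν,k} ∑_j (-1)^j (k choose j) / ((μ)_j (ν)_{k-j}) f^{(j)}(ζ) g^{(k-j)}(ζ)`. The
elementary tensors span a dense subspace, so this formula determines `P_k`. -/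
def proj (μ ν k : ℕ) [Fact (1 < μ)] [Fact (1 < ν)] :
    HTensor (Bergman μ) (Bergman ν) →L[ℂ] Bergman (μ + ν + 2 * k) :=
  (exists_proj μ ν k).choose

theorem proj_htmul (μ ν k : ℕ) [Fact (1 < μ)] [Fact (1 < ν)] (f : Bergman μ) (g : Bergman ν) (ζ : ℂ)
    (hζ : ζ ∈ 𝔻) : proj μ ν k (htmul f g) ζ = transvectant μ ν k f g ζ :=
  (exists_proj μ ν k).choose_spec.1 f g ζ hζ

theorem proj_comp_adjoint (μ ν k : ℕ) [Fact (1 < μ)] [Fact (1 < ν)] :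
    proj μ ν k ∘L (proj μ ν k).adjoint = ContinuousLinearMap.id ℂ _ :=
  (exists_proj μ ν k).choose_spec.2

/-- The quantum channel `A ↦ P_k (A ⊗ I_ν) P_k^*` from `B(𝓗_μ)` to `B(𝓗_{μ+ν+2k})`. -/
def channel (μ ν k : ℕ) [Fact (1 < μ)] [Fact (1 < ν)] :
    (Bergman μ →L[ℂ] Bergman μ) →ₗ[ℂ]
      (Bergman (μ + ν + 2 * k) →L[ℂ] Bergman (μ + ν + 2 * k)) where
  toFun A := proj μ ν k ∘L tensorId (Bergman ν) A ∘L (proj μ ν k).adjoint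
  map_add' A B := by
    rw [tensorId_add, ContinuousLinearMap.add_comp, ContinuousLinearMap.comp_add]
  map_smul' c A := by
    rw [tensorId_smul, ContinuousLinearMap.smul_comp, ContinuousLinearMap.comp_smul,
      RingHom.id_apply]

/-- A bounded operator `A` on a Hilbert space is of trace class if `∑ ⟨e_i, |A| e_i⟩ < ∞` for
orthonormal bases `(e_i)`, where `|A| = (A^* A)^{1/2}`. Each orthonormal basis can be indexed by a set
of vectors of the space. -/
def IsTraceClass {H : Type} [NormedAddCommGroup H] [InnerProductSpace ℂ H] [CompleteSpace H]
    (A : H →L[ℂ] H) : Prop :=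
  ∀ (s : Set H) (b : HilbertBasis s ℂ H), Summable fun i => ⟪b i, CFC.abs A (b i)⟫_ℂ

/-- `Tr A = t`: the sum `∑ ⟨e_i, A e_i⟩` converges (unconditionally) to `t` for all orthonormal
bases `(e_i)`. Since orthonormal bases exist, `t` is unique. -/
def HasTrace {H : Type} [NormedAddCommGroup H] [InnerProductSpace ℂ H] [CompleteSpace H]
    (A : H →L[ℂ] H) (t : ℂ) : Prop :=
  ∀ (s : Set H) (b : HilbertBasis s ℂ H), HasSum (fun i => ⟪b i, A (b i)⟫_ℂ) t

/-- Complete positivity: `Φ` applied entrywise maps positive matrices over the first algebra to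
positive matrices over the second, for matrices of each size. -/
def IsCompletelyPositive {H K : Type} [NormedAddCommGroup H] [InnerProductSpace ℂ H]
    [CompleteSpace H] [NormedAddCommGroup K] [InnerProductSpace ℂ K] [CompleteSpace K]
    (Φ : (H →L[ℂ] H) →ₗ[ℂ] (K →L[ℂ] K)) : Prop :=
  ∃ Ψ : CompletelyPositiveMap (H →L[ℂ] H) (K →L[ℂ] K), Ψ.toLinearMap = Φ

end SU11

end

/-! Write `X A` for `(A ⊗ I) P_k^*`, which is `dilation`. Since `A ↦ A ⊗ I` is a ⋆-homomorphism,
`channel (A† B) = (X A)† (X B)` (`channel_adjoint_comp`), and both claims rest on this identity.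
Complete positivity: a positive matrix over `B(H)` is `N* N`, so applying the channel entrywise
gives entries `∑ l, X(N l i)† X(N l j)`. This is a sum of Gram matrices of operators, hence positive
(`gram_nonneg`). Trace: a trace class `A` factors as `B† C` with `B`, `C` Hilbert–Schmidt. The
adjoint of `X B` sends `e_a ⊗ e_j` to `P_k(B† e_a ⊗ e_j)`. Everything therefore reduces to the sum
over `j` of `⟨P_k(f ⊗ e_j), P_k(g ⊗ e_j)⟩`, which equals `c ⟨f, g⟩` with `c = (μ+ν+2k-1)/(μ-1)`
(`hasSum_inner_slice`). In other words, the partial trace of `P_k^* P_k` over the second factor is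
the scalar `c`. Hence `X B` and `X C` are Hilbert–Schmidt, and the trace of the image is `c` times
the trace of `A`. That the partial trace is scalar is an instance of Schur's lemma, but it is
checked here on monomials (`hasSum_tau_sq`). In row `a = 0` the sum over `b` is a Gauss sum
`₂F₁(...; 1)`. Passing from row `a` to row `a + 1` changes the summand by a telescoping difference
(`tau_sq_telescope`), built from the raising and lowering recursions of the transvectant
coefficients. -/

noncomputable section

namespace SU11

open MeasureTheory Metric Complex
open scoped ComplexConjugate TensorProduct InnerProductSpace ENNReal

/-! ### Hilbert–Schmidt operators and the factorization of trace class operators. -/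

section HilbertSchmidt

set_option linter.unusedSectionVars false

variable {E F G : Type} [NormedAddCommGroup E] [InnerProductSpace ℂ E] [CompleteSpace E]
  [NormedAddCommGroup F] [InnerProductSpace ℂ F] [CompleteSpace F]
  [NormedAddCommGroup G] [InnerProductSpace ℂ G] [CompleteSpace G]
  {ι κ : Type}

theorem hasSum_norm_inner_sq (b : HilbertBasis ι ℂ E) (x : E) :
    HasSum (fun i => ‖⟪b i, x⟫_ℂ‖ ^ 2) (‖x‖ ^ 2) := by
  have h := b.hasSum_inner_mul_inner x x
  rw [inner_self_eq_norm_sq_to_K] at h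
  have h2 : (fun i => ⟪x, b i⟫_ℂ * ⟪b i, x⟫_ℂ) = fun i => ((‖⟪b i, x⟫_ℂ‖ ^ 2 : ℝ) : ℂ) := by
    funext i
    rw [← inner_conj_symm x (b i), Complex.conj_mul']
    simp
  have h3 : ((‖x‖ : ℂ) ^ 2) = ((‖x‖ ^ 2 : ℝ) : ℂ) := by simp
  rw [h2] at h
  exact Complex.hasSum_ofReal.1 (h3 ▸ h)

theorem tsum_enorm_inner_sq (b : HilbertBasis ι ℂ E) (x : E) :
    ∑' i, ‖⟪b i, x⟫_ℂ‖ₑ ^ 2 = ‖x‖ₑ ^ 2 := by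
  have h := hasSum_norm_inner_sq b x
  have h2 := ENNReal.ofReal_tsum_of_nonneg (fun i => by positivity) h.summable
  rw [h.tsum_eq] at h2
  simp only [← ofReal_norm, ← ENNReal.ofReal_pow (norm_nonneg _)]
  exact h2.symm

/-- Both sides are the double sum of `|⟨c_j, S b_i⟩|²`, taken in the two orders. As the right side
does not involve `b`, this also gives basis independence of the Hilbert–Schmidt norm. -/
theorem tsum_enorm_sq_adjoint (b : HilbertBasis ι ℂ E) (c : HilbertBasis κ ℂ F) (S : E →L[ℂ] F) :
    ∑' i, ‖S (b i)‖ₑ ^ 2 = ∑' j, ‖S.adjoint (c j)‖ₑ ^ 2 := by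
  simp_rw [← tsum_enorm_inner_sq c, ← tsum_enorm_inner_sq b]
  rw [ENNReal.tsum_comm]
  refine tsum_congr fun j => tsum_congr fun i => ?_
  rw [ContinuousLinearMap.adjoint_inner_right, ← inner_conj_symm]
  simp only [← ofReal_norm, RCLike.norm_conj]

/-- Hilbert–Schmidt operators between Hilbert spaces. -/
def IsHilbertSchmidt (S : E →L[ℂ] F) : Prop :=
  ∀ (ι : Type) (b : HilbertBasis ι ℂ E), ∑' i, ‖S (b i)‖ₑ ^ 2 ≠ ⊤

theorem IsHilbertSchmidt.of_basis {S : E →L[ℂ] F} (b : HilbertBasis ι ℂ E)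
    (h : ∑' i, ‖S (b i)‖ₑ ^ 2 ≠ ⊤) : IsHilbertSchmidt S := by
  intro κ b'
  obtain ⟨s, c, -⟩ := exists_hilbertBasis ℂ F
  rwa [tsum_enorm_sq_adjoint b' c, ← tsum_enorm_sq_adjoint b c]

theorem IsHilbertSchmidt.adjoint {S : E →L[ℂ] F} (h : IsHilbertSchmidt S) :
    IsHilbertSchmidt S.adjoint := by
  intro κ c
  obtain ⟨s, b, -⟩ := exists_hilbertBasis ℂ E
  rw [← tsum_enorm_sq_adjoint b c]
  exact h _ b

theorem IsHilbertSchmidt.comp_left {S : E →L[ℂ] F} (h : IsHilbertSchmidt S) (T : F →L[ℂ] G) :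
    IsHilbertSchmidt (T ∘L S) := by
  intro ι b
  refine ne_top_of_le_ne_top (ENNReal.mul_ne_top (a := ‖T‖ₑ ^ 2) (by simp) (h ι b)) ?_
  rw [← ENNReal.tsum_mul_left]
  refine ENNReal.tsum_le_tsum fun i => ?_
  rw [← mul_pow]
  gcongr
  exact T.le_opENorm _

theorem IsHilbertSchmidt.comp_right {S : F →L[ℂ] G} (h : IsHilbertSchmidt S) (T : E →L[ℂ] F) :
    IsHilbertSchmidt (S ∘L T) := by
  have := (h.adjoint.comp_left T.adjoint).adjoint
  rwa [ContinuousLinearMap.adjoint_comp, ContinuousLinearMap.adjoint_adjoint,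
    ContinuousLinearMap.adjoint_adjoint] at this

theorem IsHilbertSchmidt.summable_inner_sq {S : E →L[ℂ] F} (h : IsHilbertSchmidt S)
    (b : HilbertBasis ι ℂ E) (c : HilbertBasis κ ℂ F) :
    Summable fun p : ι × κ => ‖⟪c p.2, S (b p.1)⟫_ℂ‖ ^ 2 := by
  have h1 : ∑' p : ι × κ, ‖⟪c p.2, S (b p.1)⟫_ℂ‖ₑ ^ 2 ≠ ⊤ := by
    rw [ENNReal.tsum_prod (f := fun i j => ‖⟪c j, S (b i)⟫_ℂ‖ₑ ^ 2)]
    simp_rw [tsum_enorm_inner_sq c]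
    exact h ι b
  refine (ENNReal.summable_toReal h1).congr fun p => ?_
  simp

theorem IsHilbertSchmidt.summable_inner_mul_inner {B C : E →L[ℂ] F} (hB : IsHilbertSchmidt B)
    (hC : IsHilbertSchmidt C) (b : HilbertBasis ι ℂ E) (c : HilbertBasis κ ℂ F) :
    Summable fun p : ι × κ => ⟪B (b p.1), c p.2⟫_ℂ * ⟪c p.2, C (b p.1)⟫_ℂ := by
  refine Summable.of_norm_bounded
    ((hB.summable_inner_sq b c).add (hC.summable_inner_sq b c)) fun p => ?_
  rw [norm_mul, norm_inner_symm]
  -- For real `u`, `v` one has `|u v| ≤ u² + v²`.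
  nlinarith only [sq_nonneg (‖⟪c p.2, B (b p.1)⟫_ℂ‖ - ‖⟪c p.2, C (b p.1)⟫_ℂ‖),
    sq_nonneg ‖⟪c p.2, B (b p.1)⟫_ℂ‖, sq_nonneg ‖⟪c p.2, C (b p.1)⟫_ℂ‖]

/-- The two expressions for the trace of `B† C`. -/
theorem IsHilbertSchmidt.exists_hasSum_inner {B C : E →L[ℂ] F} (hB : IsHilbertSchmidt B)
    (hC : IsHilbertSchmidt C) (b : HilbertBasis ι ℂ E) (c : HilbertBasis κ ℂ F) :
    ∃ t : ℂ, HasSum (fun i => ⟪B (b i), C (b i)⟫_ℂ) t ∧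
      HasSum (fun j => ⟪C.adjoint (c j), B.adjoint (c j)⟫_ℂ) t := by
  obtain ⟨t, ht⟩ := hB.summable_inner_mul_inner hC b c
  -- The double series converges absolutely. Summing it over `j` first gives one expression, and
  -- over `i` first the other, both by Parseval.
  have ht' := (Equiv.prodComm κ ι).hasSum_iff.2 ht
  refine ⟨t, ht.prod_fiberwise fun i => c.hasSum_inner_mul_inner (B (b i)) (C (b i)),
    ht'.prod_fiberwise fun j => ?_⟩
  have h := b.hasSum_inner_mul_inner (C.adjoint (c j)) (B.adjoint (c j))
  have h2 : ∀ i, ⟪C.adjoint (c j), b i⟫_ℂ * ⟪b i, B.adjoint (c j)⟫_ℂ =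
      ⟪B (b i), c j⟫_ℂ * ⟪c j, C (b i)⟫_ℂ := fun i => by
    rw [ContinuousLinearMap.adjoint_inner_left, ContinuousLinearMap.adjoint_inner_right, mul_comm]
  simp only [h2] at h
  exact h

/-- The Douglas factorization lemma. -/
theorem exists_factor_of_norm_le {S : E →L[ℂ] F} {T : E →L[ℂ] G} (h : ∀ x, ‖S x‖ ≤ ‖T x‖) :
    ∃ W : G →L[ℂ] F, S = W ∘L T := by
  set R := T.range.topologicalClosure with hR
  -- The factor `W` is `T x ↦ S x` on the range of `T`. It is well defined and contractive by `h`,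
  -- extends to the closure `R`, and is set to zero on the orthogonal complement of `R`.
  let e : E →ₗ[ℂ] R := T.toLinearMap.codRestrict R fun x =>
    Submodule.le_topologicalClosure _ (LinearMap.mem_range_self _ x)
  have he : DenseRange e := by
    intro y
    rw [closure_subtype]
    have hy : (y : G) ∈ closure (T.range : Set G) := y.2
    refine closure_mono ?_ hy
    rintro _ ⟨x, rfl⟩
    exact ⟨e x, ⟨x, rfl⟩, rfl⟩
  have hn : ∃ C : ℝ, ∀ x, ‖S.toLinearMap x‖ ≤ C * ‖e x‖ := ⟨1, fun x => by
    rw [one_mul]; exact h x⟩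
  have : CompleteSpace R := (T.range.isClosed_topologicalClosure).completeSpace_coe
  refine ⟨(S.toLinearMap.extendOfNorm e) ∘L R.orthogonalProjectionOnto, ?_⟩
  ext x
  have h1 : R.orthogonalProjectionOnto (T x) = e x :=
    Submodule.orthogonalProjectionOnto_mem_subspace_eq_self (e x)
  rw [ContinuousLinearMap.comp_apply, ContinuousLinearMap.comp_apply, h1,
    LinearMap.extendOfNorm_eq he hn]
  rfl

/-- The operator `A† A` determines `‖A x‖² = ⟨A† A x, x⟩`. -/
theorem adjoint_mul_self_norm {A B : E →L[ℂ] E} (h : star A * A = star B * B) (x : E) :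
    ‖A x‖ = ‖B x‖ := by
  have h1 : ∀ C : E →L[ℂ] E, ⟪(star C * C) x, x⟫_ℂ = (‖C x‖ : ℂ) ^ 2 := fun C => by
    rw [mul_apply_eq_comp, ContinuousLinearMap.star_eq_adjoint,
      ContinuousLinearMap.adjoint_inner_left, inner_self_eq_norm_sq_to_K]
    rfl
  have h2 := h1 A
  rw [h, h1 B] at h2
  have h3 : ‖B x‖ ^ 2 = ‖A x‖ ^ 2 := by exact_mod_cast h2
  exact ((pow_left_inj₀ (norm_nonneg _) (norm_nonneg _) two_ne_zero).1 h3).symm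

theorem norm_abs_apply (A : E →L[ℂ] E) (x : E) : ‖CFC.abs A x‖ = ‖A x‖ := by
  refine adjoint_mul_self_norm ?_ x
  rw [(CFC.abs_nonneg A).isSelfAdjoint.star_eq, CFC.abs_mul_abs]

/-- Douglas' lemma gives `A = W |A|`, so `A = (W R) R` with `R = |A|^{1/2}`. The operator `R` is
Hilbert–Schmidt because `‖R b_i‖² = ⟨b_i, |A| b_i⟩`. -/
theorem IsTraceClass.exists_factor {A : E →L[ℂ] E} (hA : IsTraceClass A) :
    ∃ B C : E →L[ℂ] E, IsHilbertSchmidt B ∧ IsHilbertSchmidt C ∧ A = B.adjoint ∘L C := by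
  obtain ⟨W, hW⟩ := exists_factor_of_norm_le (fun x => (norm_abs_apply A x).ge)
  set R := CFC.sqrt (CFC.abs A) with hRdef
  have hR2 : R * R = CFC.abs A := CFC.sqrt_mul_sqrt_self _ (CFC.abs_nonneg A)
  have hRs : ContinuousLinearMap.adjoint R = R := (CFC.sqrt_nonneg (CFC.abs A)).isSelfAdjoint.star_eq
  have hR : IsHilbertSchmidt R := by
    obtain ⟨s, b, -⟩ := exists_hilbertBasis ℂ E
    refine IsHilbertSchmidt.of_basis b ?_
    have h1 := (hA s b).norm
    have h2 : ∀ i, ‖⟪b i, CFC.abs A (b i)⟫_ℂ‖ = ‖R (b i)‖ ^ 2 := fun i => by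
      rw [← hR2, mul_apply_eq_comp]
      nth_rewrite 1 [← hRs]
      rw [ContinuousLinearMap.adjoint_inner_right, inner_self_eq_norm_sq_to_K]
      simp
    simp_rw [h2] at h1
    have h3 := h1.tsum_ofReal_ne_top
    simpa only [ENNReal.ofReal_pow (norm_nonneg _), ofReal_norm] using h3
  refine ⟨ContinuousLinearMap.adjoint (W ∘L R), R, (hR.comp_left W).adjoint, hR, ?_⟩
  rw [ContinuousLinearMap.adjoint_adjoint, hW, ← hR2]
  rfl

/-- Douglas' lemma in the other direction gives `|B† C| = W B† C`, so the diagonal entries of the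
modulus are `⟨B W† b_i, C b_i⟩`. These are summable since `B W†` and `C` are Hilbert–Schmidt. -/
theorem IsHilbertSchmidt.isTraceClass {B C : E →L[ℂ] F} (hB : IsHilbertSchmidt B)
    (hC : IsHilbertSchmidt C) : IsTraceClass (B.adjoint ∘L C) := by
  intro s b
  obtain ⟨W, hW⟩ := exists_factor_of_norm_le (fun x => (norm_abs_apply (B.adjoint ∘L C) x).le)
  obtain ⟨κ, c, -⟩ := exists_hilbertBasis ℂ F
  obtain ⟨t, ht, -⟩ := (hB.comp_right W.adjoint).exists_hasSum_inner hC b c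
  refine ht.summable.congr fun i => ?_
  rw [hW]
  simp only [ContinuousLinearMap.comp_apply]
  rw [← ContinuousLinearMap.adjoint_inner_right, ← ContinuousLinearMap.adjoint_inner_left W]

/-- The sum over the fixed basis `c` of the intermediate space pins down the diagonal sum for every
basis `b` at once. The trace may thus be computed wherever the adjoints are explicit. -/
theorem IsHilbertSchmidt.hasTrace {B C : E →L[ℂ] F} (hB : IsHilbertSchmidt B)
    (hC : IsHilbertSchmidt C) (c : HilbertBasis κ ℂ F) {t : ℂ}
    (ht : HasSum (fun j => ⟪C.adjoint (c j), B.adjoint (c j)⟫_ℂ) t) :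
    HasTrace (B.adjoint ∘L C) t := by
  intro s b
  obtain ⟨t', h1, h2⟩ := hB.exists_hasSum_inner hC b c
  rw [ht.unique h2]
  simpa only [ContinuousLinearMap.comp_apply, ContinuousLinearMap.adjoint_inner_right] using h1

end HilbertSchmidt

/-! ### Positivity of Gram matrices of operators and complete positivity. -/

section CompletePositivity

variable {H K : Type} [NormedAddCommGroup H] [InnerProductSpace ℂ H] [CompleteSpace H]
  [NormedAddCommGroup K] [InnerProductSpace ℂ K] [CompleteSpace K]

theorem adjoint_comp_self_nonneg (X : H →L[ℂ] K) : 0 ≤ X.adjoint ∘L X :=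
  (ContinuousLinearMap.nonneg_iff_isPositive _).2 (ContinuousLinearMap.isPositive_adjoint_comp_self X)

theorem eq_zero_of_sum_adjoint_comp_self {m : Type} [Fintype m] (X : m → H →L[ℂ] K)
    (h : ∑ l, (X l).adjoint ∘L X l ≤ 0) (l : m) : X l = 0 := by
  have h0 : ∑ l, (X l).adjoint ∘L X l = 0 :=
    le_antisymm h (Finset.sum_nonneg fun l _ => adjoint_comp_self_nonneg (X l))
  have h1 := (Finset.sum_eq_zero_iff_of_nonneg
    (fun l _ => adjoint_comp_self_nonneg (X l))).1 h0 l (Finset.mem_univ l)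
  ext x
  have h2 : ⟪((X l).adjoint ∘L X l) x, x⟫_ℂ = 0 := by rw [h1]; simp
  rw [ContinuousLinearMap.comp_apply, ContinuousLinearMap.adjoint_inner_left,
    inner_self_eq_zero] at h2
  simpa using h2

/-- A self-adjoint element of a C⋆-algebra is positive if none of its conjugates is negative. -/
theorem nonneg_of_conjugate {𝒜 : Type} [NonUnitalCStarAlgebra 𝒜] [PartialOrder 𝒜]
    [StarOrderedRing 𝒜] {M : 𝒜} (hsa : IsSelfAdjoint M)
    (h : ∀ Q Y : 𝒜, star Q * M * Q = -(star Y * Y) → Y = 0) : 0 ≤ M := by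
  rw [← CFC.negPart_eq_zero_iff M]
  -- Conjugating by the negative part gives `Q M Q = -Q³ = -(Z Q)*(Z Q)` with `Z = Q^{1/2}`. The
  -- hypothesis forces `Z Q = 0`, hence `Q³ = 0`, and two uses of the C⋆-identity give `Q = 0`. The
  -- argument stays inside the algebra, so matrices need not be realized as operators on a direct
  -- sum.
  set Q := M⁻ with hQ
  have hQ0 : 0 ≤ Q := CFC.negPart_nonneg M
  have hQs : star Q = Q := hQ0.isSelfAdjoint.star_eq
  have hQM : star Q * M * Q = -(star Q * Q * Q) := by
    conv_lhs => rw [← CFC.posPart_sub_negPart M, ← hQ, hQs, mul_sub, CFC.negPart_mul_posPart]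
    rw [zero_sub, neg_mul, hQs]
  set Z := CFC.sqrt Q with hZ
  have hZQ : star Z * Z = Q := by
    rw [(CFC.sqrt_nonneg Q).isSelfAdjoint.star_eq, CFC.sqrt_mul_sqrt_self Q hQ0]
  have hYY : star (Z * Q) * (Z * Q) = star Q * Q * Q := by
    rw [star_mul, mul_assoc, ← mul_assoc (star Z), hZQ, ← mul_assoc]
  have hQ3 : star Q * Q * Q = 0 := by
    rw [← hYY, h Q (Z * Q) (by rw [hQM, hYY]), mul_zero]
  have hQ2 : star (star Q * Q) * (star Q * Q) = 0 := by
    rw [star_mul, star_star, hQs]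
    rw [hQs] at hQ3
    rw [← mul_assoc, hQ3, zero_mul]
  rwa [CStarRing.star_mul_self_eq_zero_iff, CStarRing.star_mul_self_eq_zero_iff] at hQ2

theorem exists_star_mul_self_of_nonneg {𝒜 : Type} [NonUnitalCStarAlgebra 𝒜] [PartialOrder 𝒜]
    [StarOrderedRing 𝒜] {M : 𝒜} (h : 0 ≤ M) : ∃ N : 𝒜, M = star N * N :=
  CStarAlgebra.nonneg_iff_eq_star_mul_self.1 h

/-- A sum of Gram matrices of operators is positive. -/
theorem gram_nonneg {m n : Type} [Fintype m] [Fintype n] [DecidableEq n] (X : m → n → H →L[ℂ] K)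
    (M : CStarMatrix n n (H →L[ℂ] H)) (hM : ∀ i j, M i j = ∑ l, (X l i).adjoint ∘L X l j) :
    0 ≤ M := by
  have hsa : IsSelfAdjoint M := by
    ext1 i j
    rw [CStarMatrix.star_apply, hM, hM, star_sum]
    refine Finset.sum_congr rfl fun l _ => ?_
    rw [ContinuousLinearMap.star_eq_adjoint, ContinuousLinearMap.adjoint_comp,
      ContinuousLinearMap.adjoint_adjoint]
  refine nonneg_of_conjugate hsa fun Q Y hQY => ?_
  -- Diagonal entries suffice: those of `Q* M Q` are sums of `T† T`, while those of `-(Y* Y)` are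
  -- `-∑ l, Y(l,j)† Y(l,j)`. If the two matrices agree, each column of `Y` vanishes.
  have hdiag : ∀ j, 0 ≤ (star Q * M * Q) j j := by
    intro j
    have : (star Q * M * Q) j j = ∑ l, (∑ i, X l i ∘L Q i j).adjoint ∘L (∑ i, X l i ∘L Q i j) := by
      simp only [CStarMatrix.mul_apply, CStarMatrix.star_apply, hM, Finset.sum_mul, Finset.mul_sum,
        map_sum]
      ext x
      simp only [_root_.sum_apply, ContinuousLinearMap.comp_apply,
        mul_apply_eq_comp, map_sum, ContinuousLinearMap.adjoint_comp,
        ContinuousLinearMap.star_eq_adjoint]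
      rw [Finset.sum_comm_cycle]
    rw [this]
    exact Finset.sum_nonneg fun l _ => adjoint_comp_self_nonneg _
  ext1 l j
  have h1 := hdiag j
  rw [hQY, CStarMatrix.neg_apply, Left.nonneg_neg_iff, CStarMatrix.mul_apply] at h1
  exact eq_zero_of_sum_adjoint_comp_self (fun l => Y l j) h1 l

/-- A linear map with `Φ (A† B) = X(A)† X(B)` is completely positive. -/
theorem isCompletelyPositive_of_apply_adjoint_comp {L : Type} [NormedAddCommGroup L] [InnerProductSpace ℂ L]
    [CompleteSpace L] (Φ : (H →L[ℂ] H) →ₗ[ℂ] (K →L[ℂ] K)) (X : (H →L[ℂ] H) → K →L[ℂ] L)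
    (h : ∀ A B, Φ (A.adjoint ∘L B) = (X A).adjoint ∘L X B) : IsCompletelyPositive Φ := by
  refine ⟨⟨Φ, fun n M hM => ?_⟩, rfl⟩
  obtain ⟨N, rfl⟩ := exists_star_mul_self_of_nonneg hM
  refine gram_nonneg (fun l i => X (N l i)) _ fun i j => ?_
  rw [CStarMatrix.map_apply, CStarMatrix.mul_apply]
  change Φ _ = _
  rw [map_sum]
  exact Finset.sum_congr rfl fun l _ => h _ _

end CompletePositivity

/-! ### Telescoping series, growth of the weights, and Gauss summation. -/

section Sums

open Filter Topology

theorem hasSum_congr_value {f : ℕ → ℝ} {s t : ℝ} (h : HasSum f s) (hst : t = s) :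
    HasSum f t := hst ▸ h

/-- Nonnegativity of `g` upgrades convergence of the partial sums to unconditional summability. -/
theorem hasSum_of_telescope {f g H : ℕ → ℝ} {s : ℝ} (hf : HasSum f s) (hg : ∀ b, 0 ≤ g b)
    (h : ∀ b, g b = f b + (H b - H (b + 1))) (hH : Tendsto H atTop (𝓝 0)) :
    HasSum g (s + H 0) := by
  rw [hasSum_iff_tendsto_nat_of_nonneg hg]
  have h1 : ∀ n, ∑ i ∈ Finset.range n, g i = ∑ i ∈ Finset.range n, f i + (H 0 - H n) := fun n => by
    rw [Finset.sum_congr rfl fun b _ => h b, Finset.sum_add_distrib, Finset.sum_range_sub']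
  simp_rw [h1]
  have h2 := hf.tendsto_sum_nat.add (hH.const_sub (H 0))
  rwa [sub_zero] at h2

theorem tendsto_zero_of_mul_le {H : ℕ → ℝ} {C : ℝ} (h : ∀ n, |H n| * (n + 1) ≤ C) :
    Tendsto H atTop (𝓝 0) := by
  refine squeeze_zero_norm (a := fun n : ℕ => C * (1 / ((n : ℝ) + 1))) (fun n => ?_) ?_
  · rw [mul_one_div, le_div_iff₀ (by positivity)]
    exact h n
  · simpa using (tendsto_one_div_add_atTop_nhds_zero_nat (𝕜 := ℝ)).const_mul C

/-- Together with `le_wt`: the weight is the binomial coefficient `(m+p choose p)`, which is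
comparable to `(m+1)^p`. These bounds turn the vanishing of boundary terms into a count of
exponents. -/
theorem wt_le (p m : ℕ) : wt (p + 1) m ≤ (p + 1) ^ p * ((m : ℝ) + 1) ^ p := by
  rw [wt_eq_choose, ← mul_pow]
  have h : (m + p).choose p ≤ ((p + 1) * (m + 1)) ^ p :=
    (Nat.choose_le_pow _ _).trans (Nat.pow_le_pow_left (by nlinarith) _)
  exact_mod_cast h

theorem le_wt (p m : ℕ) : ((m : ℝ) + 1) ^ p ≤ p.factorial * wt (p + 1) m := by
  rw [wt_eq_choose]
  have h := Nat.pow_le_choose (α := ℝ) p (m + p)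
  have h2 : (((m + p + 1 - p : ℕ) ^ p : ℕ) : ℝ) ≤ p.factorial * (m + p).choose p := by
    have := (div_le_iff₀ (by positivity)).1 h
    push_cast at this ⊢
    linarith
  rw [show m + p + 1 - p = m + 1 by omega] at h2
  exact_mod_cast h2

theorem wt_succ_eq_mul (p m : ℕ) : (p + 1) * wt (p + 2) m = (p + 1 + m) * wt (p + 1) m := by
  rw [wt, wt]
  have h : (p + 1) * (p + 2).ascFactorial m = (p + 1 + m) * (p + 1).ascFactorial m := by
    rw [← Nat.ascFactorial_succ]
    exact Nat.succ_ascFactorial (p + 1) m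
  have h2 : ((p : ℝ) + 1) * (p + 2).ascFactorial m = (p + 1 + m) * (p + 1).ascFactorial m := by
    exact_mod_cast h
  rw [← mul_div_assoc, ← mul_div_assoc, h2]

theorem wt_add_one_pos (p m : ℕ) : 0 < wt (p + 1) m := by
  rw [wt_eq_choose]
  exact_mod_cast Nat.choose_pos (by omega)

/-- The term ratio of a hypergeometric series, cleared of denominators. -/
theorem wt_div_wt_succ (q r m : ℕ) :
    ((r : ℝ) + 1 + m) * (wt (q + 1) (m + 1) / wt (r + 1) (m + 1)) =
      (q + 1 + m) * (wt (q + 1) m / wt (r + 1) m) := by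
  have e1 := wt_succ (q + 1) m
  have e2 := wt_succ (r + 1) m
  have w3 := (wt_add_one_pos r m).ne'
  have w4 := (wt_add_one_pos r (m + 1)).ne'
  have hm : (m : ℝ) + 1 ≠ 0 := by positivity
  push_cast at e1 e2
  rw [← mul_div_assoc, ← mul_div_assoc, div_eq_div_iff w4 w3]
  apply mul_left_cancel₀ hm
  linear_combination (r + 1 + m) * wt (r + 1) m * e1 - (q + 1 + m) * wt (q + 1) m * e2

/-- The bound has order `m^(a+p+q-r)`, and the exponent is at most `-1`. -/
theorem tendsto_zero_of_le_wt {H : ℕ → ℝ} {C : ℝ} {a p q r : ℕ} (hr : a + p + q < r)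
    (h : ∀ m : ℕ, |H m| ≤ C * ((m : ℝ) + 1) ^ a * (wt (p + 1) m * wt (q + 1) m / wt (r + 1) m)) :
    Tendsto H atTop (𝓝 0) := by
  refine tendsto_zero_of_mul_le (C := |C| * ((p + 1) ^ p * (q + 1) ^ q * r.factorial)) fun m => ?_
  have w1 := wt_add_one_pos p m
  have w2 := wt_add_one_pos q m
  have w3 := wt_add_one_pos r m
  have b1 := wt_le p m
  have b2 := wt_le q m
  have b3 := le_wt r m
  have hm : (1 : ℝ) ≤ m + 1 := by linarith [show (0 : ℝ) ≤ m by positivity]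
  calc |H m| * (m + 1)
      ≤ |C| * ((m : ℝ) + 1) ^ a * (wt (p + 1) m * wt (q + 1) m / wt (r + 1) m) * (m + 1) := by
        have := h m
        have := le_abs_self C
        gcongr
        refine (h m).trans ?_
        gcongr
    _ = |C| * (((m : ℝ) + 1) ^ (a + 1) * (wt (p + 1) m * wt (q + 1) m)) / wt (r + 1) m := by ring
    _ ≤ _ := ?_
  rw [div_le_iff₀ w3]
  calc |C| * (((m : ℝ) + 1) ^ (a + 1) * (wt (p + 1) m * wt (q + 1) m))
      ≤ |C| * (((m : ℝ) + 1) ^ (a + 1) * (((p + 1) ^ p * ((m : ℝ) + 1) ^ p) *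
          ((q + 1) ^ q * ((m : ℝ) + 1) ^ q))) := by gcongr
    _ = |C| * ((p + 1) ^ p * (q + 1) ^ q) * ((m : ℝ) + 1) ^ (a + p + q + 1) := by ring
    _ ≤ |C| * ((p + 1) ^ p * (q + 1) ^ q) * ((m : ℝ) + 1) ^ r := by
        have := pow_le_pow_right₀ hm (show a + p + q + 1 ≤ r by omega)
        gcongr
    _ ≤ |C| * ((p + 1) ^ p * (q + 1) ^ q) * (r.factorial * wt (r + 1) m) := by gcongr
    _ = _ := by ring

/-- The Gauss summation theorem for `₂F₁(p + 1, q + 1; p + q + d + 3; 1)`. -/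
theorem hasSum_gauss (p q d : ℕ) :
    HasSum (fun m => wt (p + 1) m * wt (q + 1) m / wt (p + q + d + 3) m)
      ((p + q + d + 2).factorial * d.factorial /
        ((q + d + 1).factorial * (p + d + 1).factorial)) := by
  -- Raising `p` by one while lowering `d` by one keeps the lower parameter `p+q+d+3` fixed, so the
  -- inductive hypothesis is needed at `d + 1`.
  induction p generalizing d with
  | zero =>
    have hd : (d : ℝ) + 1 ≠ 0 := by positivity
    have hone : ∀ m, wt (0 + 1) m = 1 := fun m => by rw [wt_eq_choose]; simp
    -- With one upper parameter equal to `1` the series telescopes by itself, since `(m+1+q+d+2)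
    -- u(m+1) = (q+1+m) u(m)` for the summand `u`; the sum is `H 0 / (d+1)`.
    have h1 := hasSum_of_telescope (f := 0) (s := 0)
      (g := fun m => (d + 1) * (wt (q + 1) m / wt (q + d + 3) m))
      (H := fun m => (q + d + 2 + m) * (wt (q + 1) m / wt (q + d + 3) m)) hasSum_zero
      (fun m => by
        have := wt_add_one_pos q m; have := wt_add_one_pos (q + d + 2) m
        positivity) ?_ ?_
    · have h2 := h1.mul_left ((d : ℝ) + 1)⁻¹
      simp only [inv_mul_cancel_left₀ hd] at h2
      simp only [hone, one_mul, zero_add]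
      refine hasSum_congr_value h2 ?_
      have w : ∀ x, wt x 0 = 1 := fun x => by simp [wt]
      rw [w, w, show q + d + 2 = q + d + 1 + 1 by ring, Nat.factorial_succ (q + d + 1),
        Nat.factorial_succ d]
      have f1 : ((q + d + 1).factorial : ℝ) ≠ 0 := by positivity
      have f2 : (d.factorial : ℝ) ≠ 0 := by positivity
      push_cast
      field_simp
      ring
    · intro m
      have e := wt_div_wt_succ q (q + d + 2) m
      simp only [Pi.zero_apply]
      push_cast at e ⊢
      linear_combination e
    · refine tendsto_zero_of_le_wt (C := q + d + 2) (a := 1) (p := 0) (q := q) (r := q + d + 2)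
        (by omega) fun m => ?_
      have w1 := wt_add_one_pos q m
      have w2 := wt_add_one_pos (q + d + 2) m
      rw [abs_of_nonneg (by positivity), hone, one_mul]
      gcongr
      nlinarith [show (0 : ℝ) ≤ (q + d + 1) * m by positivity]
  | succ p ih =>
    have hd : (d : ℝ) + 1 ≠ 0 := by positivity
    have hp : (p : ℝ) + 1 ≠ 0 := by positivity
    have h0 := (ih (d + 1)).mul_left ((q : ℝ) + d + 2)
    -- The contiguous relation `(d+1) F(p+2) = (q+d+2) F(p+1)`, proved termwise with a telescoping
    -- certificate `H`. Its factor `m` makes `H 0 = 0`, so no boundary term survives.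
    have h1 := hasSum_of_telescope (g := fun m => (d + 1) *
        (wt (p + 2) m * wt (q + 1) m / wt (p + q + (d + 1) + 3) m))
      (H := fun m => m * (p + q + d + 3 + m) / (p + 1) *
        (wt (p + 1) m * wt (q + 1) m / wt (p + q + (d + 1) + 3) m)) h0
      (fun m => by
        have := wt_add_one_pos (p + 1) m
        have := wt_add_one_pos q m
        have := wt_add_one_pos (p + q + (d + 1) + 2) m
        positivity) ?_ ?_
    · have h2 := h1.mul_left ((d : ℝ) + 1)⁻¹
      simp only [inv_mul_cancel_left₀ hd] at h2
      rw [show p + 1 + q + d + 3 = p + q + (d + 1) + 3 by ring]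
      refine hasSum_congr_value h2 ?_
      rw [show p + 1 + q + d + 2 = p + q + (d + 1) + 2 by ring,
        show q + (d + 1) + 1 = q + d + 1 + 1 by ring, Nat.factorial_succ (q + d + 1),
        show p + (d + 1) + 1 = p + 1 + d + 1 by ring, Nat.factorial_succ d]
      have f1 : ((q + d + 1).factorial : ℝ) ≠ 0 := by positivity
      have f2 : ((p + 1 + d + 1).factorial : ℝ) ≠ 0 := by positivity
      have f3 : (q + d + 1 + 1 : ℝ) ≠ 0 := by positivity
      push_cast
      field_simp
      ring
    · intro m
      have e := wt_div_wt_succ q (p + q + (d + 1) + 2) m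
      have e1 := wt_succ (p + 1) m
      have e2 := wt_succ_eq_mul p m
      push_cast at e e1 ⊢
      simp only [mul_div_assoc]
      set R := wt (q + 1) m / wt (p + q + (d + 1) + 3) m
      set R' := wt (q + 1) (m + 1) / wt (p + q + (d + 1) + 3) (m + 1)
      field_simp
      linear_combination (d + 1) * R * e2 + (p + 1 + m) * wt (p + 1) m * e +
        (p + q + (d + 1) + 2 + 1 + m) * R' * e1
    · refine tendsto_zero_of_le_wt (C := (p + q + d + 3)) (a := 2) (p := p) (q := q)
        (r := p + q + (d + 1) + 2) (by omega) fun m => ?_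
      have w0 := wt_add_one_pos p m
      have w1 := wt_add_one_pos q m
      have w2 := wt_add_one_pos (p + q + (d + 1) + 2) m
      rw [abs_of_nonneg (by positivity)]
      gcongr
      rw [div_le_iff₀ (by positivity)]
      have hm : (0 : ℝ) ≤ m := by positivity
      calc (m : ℝ) * (p + q + d + 3 + m)
          ≤ (m + 1) * ((p + q + d + 3) * (m + 1)) := by
            gcongr
            · linarith
            · nlinarith [show (0 : ℝ) ≤ (p + q + d + 2) * m by positivity]
        _ = (p + q + d + 3) * (m + 1) ^ 2 * 1 := by ring
        _ ≤ (p + q + d + 3) * (m + 1) ^ 2 * (p + 1) := by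
            gcongr
            linarith [show (0 : ℝ) ≤ p by positivity]

/-! ### Row sums of the squared transvectant coefficients. -/

theorem tau_eq_zero (μ ν : ℕ) {k a b : ℕ} (h : a + b < k) : tau μ ν k a b = 0 := by
  refine Finset.sum_eq_zero fun j _ => ?_
  by_cases ha : a < j
  · rw [Nat.descFactorial_eq_zero_iff_lt.2 ha]
    simp
  · rw [Nat.descFactorial_eq_zero_iff_lt.2 (show b < k - j by omega)]
    simp

/-- For fixed `a`, `tau` is a polynomial in `b` of degree at most `k`. -/
theorem exists_abs_tau_le (μ ν k a : ℕ) :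
    ∃ C : ℝ, 0 ≤ C ∧ ∀ b : ℕ, |tau μ ν k a b| ≤ C * ((b : ℝ) + 1) ^ k := by
  refine ⟨∑ j ∈ Finset.range (k + 1), |tcoef μ ν k j| * a.descFactorial j,
    Finset.sum_nonneg fun j _ => by positivity, fun b => ?_⟩
  rw [tau, Finset.sum_mul]
  refine (Finset.abs_sum_le_sum_abs _ _).trans (Finset.sum_le_sum fun j _ => ?_)
  have hb : (b.descFactorial (k - j) : ℝ) ≤ ((b : ℝ) + 1) ^ k := by
    have h1 : b.descFactorial (k - j) ≤ (b + 1) ^ k :=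
      (Nat.descFactorial_le_pow b (k - j)).trans
        ((Nat.pow_le_pow_left (Nat.le_succ b) _).trans
          (Nat.pow_le_pow_right (Nat.succ_pos b) (Nat.sub_le k j)))
    exact_mod_cast h1
  rw [abs_mul, abs_mul, Nat.abs_cast, Nat.abs_cast, mul_assoc]
  gcongr

/-- Shifting the index by a bounded amount costs only a constant factor, because `b ≤ (a + b - k) +
k` even with truncated subtraction. -/
theorem exists_wt_le_wt_shift (p a k : ℕ) :
    ∃ C : ℝ, 0 ≤ C ∧ ∀ b : ℕ, wt (p + 1) b ≤ C * wt (p + 1) (a + b - k) := by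
  refine ⟨(p + 1) ^ p * (k + 1) ^ p * p.factorial, by positivity, fun b => ?_⟩
  have h : ((b : ℝ) + 1) ≤ (k + 1) * (((a + b - k : ℕ) : ℝ) + 1) := by
    have h1 : b + 1 ≤ (k + 1) * ((a + b - k) + 1) := by
      have h2 : b ≤ (a + b - k) + k := by omega
      nlinarith [Nat.zero_le (k * (a + b - k))]
    exact_mod_cast h1
  calc wt (p + 1) b ≤ (p + 1) ^ p * ((b : ℝ) + 1) ^ p := wt_le p b
    _ ≤ (p + 1) ^ p * ((k + 1) * (((a + b - k : ℕ) : ℝ) + 1)) ^ p := by gcongr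
    _ = (p + 1) ^ p * (k + 1) ^ p * (((a + b - k : ℕ) : ℝ) + 1) ^ p := by rw [mul_pow, mul_assoc]
    _ ≤ (p + 1) ^ p * (k + 1) ^ p * (p.factorial * wt (p + 1) (a + b - k)) := by
        have := le_wt p (a + b - k)
        gcongr
    _ = _ := by ring

/-- The weight of `z ^ a ⊗ w ^ b` relative to its image in `𝓗_{μ+ν+2k}`. -/
def relWt (μ ν k a b : ℕ) : ℝ := wt μ a * wt ν b / wt (μ + ν + 2 * k) (a + b - k)

theorem relWt_pos (μ ν k a b : ℕ) [Fact (1 < μ)] [Fact (1 < ν)] : 0 < relWt μ ν k a b := by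
  have := wt_pos μ a
  have := wt_pos ν b
  have := wt_pos (μ + ν + 2 * k) (a + b - k)
  unfold relWt
  positivity

theorem relWt_succ_left (μ ν k a b : ℕ) [Fact (1 < μ)] [Fact (1 < ν)] (h : k ≤ a + b) :
    (a + 1) * (a + b + μ + ν + k) * relWt μ ν k (a + 1) b =
      (μ + a) * (a + b + 1 - k) * relWt μ ν k a b := by
  obtain ⟨n, hn⟩ : ∃ n, a + b = n + k := ⟨a + b - k, by omega⟩
  have hn' : (a : ℝ) + b = n + k := by exact_mod_cast hn
  have e1 := wt_succ μ a
  have e2 := wt_succ (μ + ν + 2 * k) n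
  have w1 := (wt_pos (μ + ν + 2 * k) n).ne'
  have w2 := (wt_pos (μ + ν + 2 * k) (n + 1)).ne'
  rw [relWt, relWt, show a + b - k = n by omega, show a + 1 + b - k = n + 1 by omega,
    ← mul_div_assoc, ← mul_div_assoc, div_eq_div_iff w2 w1, hn']
  push_cast at e2
  linear_combination (n + k + μ + ν + k) * wt ν b * wt (μ + ν + 2 * k) n * e1 -
    (μ + a) * wt μ a * wt ν b * e2

theorem relWt_succ_right (μ ν k a b : ℕ) [Fact (1 < μ)] [Fact (1 < ν)] (h : k ≤ a + b) :
    (b + 1) * (a + b + μ + ν + k) * relWt μ ν k a (b + 1) =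
      (ν + b) * (a + b + 1 - k) * relWt μ ν k a b := by
  obtain ⟨n, hn⟩ : ∃ n, a + b = n + k := ⟨a + b - k, by omega⟩
  have hn' : (a : ℝ) + b = n + k := by exact_mod_cast hn
  have e1 := wt_succ ν b
  have e2 := wt_succ (μ + ν + 2 * k) n
  have w1 := (wt_pos (μ + ν + 2 * k) n).ne'
  have w2 := (wt_pos (μ + ν + 2 * k) (n + 1)).ne'
  rw [relWt, relWt, show a + b - k = n by omega, show a + (b + 1) - k = n + 1 by omega,
    ← mul_div_assoc, ← mul_div_assoc, div_eq_div_iff w2 w1, hn']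
  push_cast at e2
  linear_combination (n + k + μ + ν + k) * wt μ a * wt (μ + ν + 2 * k) n * e1 -
    (ν + b) * wt ν b * wt μ a * e2

/-- Multiply `tau_raise` at `(a, b)` by `(a+b+1-k) τ(a+1,b)` and `tau_lower` at `(a+1, b)` by
`(a+b+μ+ν+k) τ(a,b)`. The right-hand sides coincide. The left-hand sides contain the squares of
`τ(a+1,b)` and `τ(a,b)`, together with two mixed products that are, once weighted, consecutive
values of a single function of `b`. -/
theorem tau_sq_telescope (μ ν k a b : ℕ) [Fact (1 < μ)] [Fact (1 < ν)] :
    tau μ ν k (a + 1) b ^ 2 * relWt μ ν k (a + 1) b =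
      tau μ ν k a b ^ 2 * relWt μ ν k a b +
        (b / (a + 1) * relWt μ ν k a b * (tau μ ν k (a + 1) (b - 1) * tau μ ν k a b) -
        ((b + 1 : ℕ) : ℝ) / (a + 1) * relWt μ ν k a (b + 1) *
          (tau μ ν k (a + 1) (b + 1 - 1) * tau μ ν k a (b + 1))) := by
  have ha : (a : ℝ) + 1 ≠ 0 := by positivity
  have hr := tau_raise μ ν k a b
  have hl := tau_lower μ ν k (a + 1) b
  simp only [Nat.add_sub_cancel]
  push_cast at hl ⊢
  rcases lt_or_ge (a + b) k with h | h
  -- Below degree `k` the index `a + b - k` is truncated and the recursions for `relWt` are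
  -- unavailable. Only the edge `a + 1 + b = k` matters: there both denominators are `wt _ 0 = 1`,
  -- and `tau_raise` has right-hand side zero.
  · rw [tau_eq_zero μ ν h] at hr ⊢
    rcases lt_or_eq_of_le (show a + 1 + b ≤ k by omega) with h' | h'
    · rw [tau_eq_zero μ ν h']
      ring
    · have e1 := wt_succ μ a
      have e2 := wt_succ ν b
      rw [relWt, relWt, relWt, show a + 1 + b - k = 0 by omega, show a + (b + 1) - k = 0 by omega]
      have w : wt (μ + ν + 2 * k) 0 = 1 := by simp [wt]
      rw [w]
      field_simp
      linear_combination tau μ ν k (a + 1) b ^ 2 * wt ν b * e1 +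
        wt μ a * tau μ ν k a (b + 1) * tau μ ν k (a + 1) b * e2 +
        wt μ a * wt ν b * tau μ ν k (a + 1) b * hr
  · have w1 := relWt_succ_left μ ν k a b h
    have w2 := relWt_succ_right μ ν k a b h
    have hM : (a : ℝ) + b + μ + ν + k ≠ 0 := by
      have : (1 : ℝ) < μ := by exact_mod_cast (Fact.out : 1 < μ)
      positivity
    field_simp
    apply mul_left_cancel₀ hM
    linear_combination tau μ ν k (a + 1) b ^ 2 * w1 +
      tau μ ν k (a + 1) b * tau μ ν k a (b + 1) * w2 +
      relWt μ ν k a b * (a + b + 1 - k) * tau μ ν k (a + 1) b * hr -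
      relWt μ ν k a b * (a + b + μ + ν + k) * tau μ ν k a b * hl

/-- The exponents of `b` are `1` from the prefactor, `2k` from the two coefficients, `ν - 1` from
the numerator weight and `-(μ+ν+2k-1)` from the denominator. Their total is `1 - μ`, which is
negative exactly because `μ > 1`. -/
theorem tendsto_telescope_zero (μ ν k a : ℕ) [hμ : Fact (1 < μ)] [hν : Fact (1 < ν)] :
    Tendsto (fun b : ℕ => (b : ℝ) / (a + 1) * relWt μ ν k a b *
      (tau μ ν k (a + 1) (b - 1) * tau μ ν k a b)) atTop (𝓝 0) := by
  obtain ⟨m, rfl⟩ : ∃ m, μ = m + 2 := ⟨μ - 2, by have := hμ.out; omega⟩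
  obtain ⟨n, rfl⟩ : ∃ n, ν = n + 1 := ⟨ν - 1, by have := hν.out; omega⟩
  obtain ⟨C₁, h₁, hC₁⟩ := exists_abs_tau_le (m + 2) (n + 1) k (a + 1)
  obtain ⟨C₂, h₂, hC₂⟩ := exists_abs_tau_le (m + 2) (n + 1) k a
  obtain ⟨C₃, h₃, hC₃⟩ := exists_wt_le_wt_shift (m + 2 + n + 2 * k) a k
  have eκ : m + 2 + (n + 1) + 2 * k = m + 2 + n + 2 * k + 1 := by ring
  have w0 := wt_pos (m + 2) a
  -- The choice `p := 0` makes one of the two numerator weights trivial.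
  refine tendsto_zero_of_le_wt (C := wt (m + 2) a * C₃ * C₁ * C₂) (a := 2 * k + 1) (p := 0)
    (q := n) (r := m + 2 + n + 2 * k) (by omega) fun b => ?_
  have w1 := wt_add_one_pos n b
  have w2 := wt_add_one_pos (m + 2 + n + 2 * k) b
  have w3 := wt_add_one_pos (m + 2 + n + 2 * k) (a + b - k)
  have hone : wt (0 + 1) b = 1 := by rw [wt_eq_choose]; simp
  have t1 : |tau (m + 2) (n + 1) k (a + 1) (b - 1)| ≤ C₁ * ((b : ℝ) + 1) ^ k := by
    refine (hC₁ (b - 1)).trans ?_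
    gcongr
    exact Nat.sub_le b 1
  have t2 := hC₂ b
  have t3 : (b : ℝ) / (a + 1) ≤ b + 1 := by
    rw [div_le_iff₀ (by positivity)]
    nlinarith [show (0 : ℝ) ≤ b * a by positivity, show (0 : ℝ) ≤ a by positivity]
  have t4 : (wt (m + 2 + n + 2 * k + 1) (a + b - k))⁻¹ ≤
      C₃ * (wt (m + 2 + n + 2 * k + 1) b)⁻¹ := by
    rw [← div_eq_mul_inv, le_div_iff₀ w2, inv_mul_le_iff₀ w3, mul_comm _ C₃]
    exact hC₃ b
  rw [abs_mul, abs_mul, abs_mul, abs_of_pos (relWt_pos _ _ _ _ _), abs_of_nonneg (by positivity),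
    relWt, eκ, hone, div_eq_mul_inv (wt (m + 2) a * wt (n + 1) b)]
  calc (b : ℝ) / (a + 1) * (wt (m + 2) a * wt (n + 1) b *
          (wt (m + 2 + n + 2 * k + 1) (a + b - k))⁻¹) *
        (|tau (m + 2) (n + 1) k (a + 1) (b - 1)| * |tau (m + 2) (n + 1) k a b|)
      ≤ (b + 1) * (wt (m + 2) a * wt (n + 1) b * (C₃ * (wt (m + 2 + n + 2 * k + 1) b)⁻¹)) *
        ((C₁ * ((b : ℝ) + 1) ^ k) * (C₂ * ((b : ℝ) + 1) ^ k)) := by gcongr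
    _ = _ := by ring

theorem tau_zero_left (μ ν k b : ℕ) :
    tau μ ν k 0 b = b.descFactorial k / ν.ascFactorial k := by
  rw [tau, Finset.sum_eq_single_of_mem 0 (by simp)]
  · simp [tcoef]
    ring
  · intro j _ hj
    rw [Nat.descFactorial_eq_zero_iff_lt.2 (Nat.pos_of_ne_zero hj)]
    simp

/-- In row `a = 0` only the term `j = 0` of the transvectant survives, so the summand is
hypergeometric: the Gauss series with `p = k`, `q = ν + k - 1`, `d = μ - 2`. -/
theorem tau_sq_zero_left (μ ν k m : ℕ) [hμ : Fact (1 < μ)] [hν : Fact (1 < ν)] :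
    tau μ ν k 0 (m + k) ^ 2 * relWt μ ν k 0 (m + k) =
      k.factorial / ν.ascFactorial k *
        (wt (k + 1) m * wt (ν + k) m / wt (μ + ν + 2 * k) m) := by
  have h0 : wt μ 0 = 1 := by simp [wt]
  have h1 : ((m + k).descFactorial k : ℝ) = k.factorial * wt (k + 1) m := by
    rw [wt_eq_choose, Nat.descFactorial_eq_factorial_mul_choose]
    push_cast
    rfl
  have h2 : ((m + k).descFactorial k : ℝ) * m.factorial = (m + k).factorial := by
    have := Nat.factorial_mul_descFactorial (show k ≤ m + k by omega)
    rw [Nat.add_sub_cancel, mul_comm] at this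
    exact_mod_cast this
  have h3 : (ν.ascFactorial (m + k) : ℝ) = ν.ascFactorial k * (ν + k).ascFactorial m := by
    have := Nat.ascFactorial_mul_ascFactorial ν k m
    rw [add_comm m k]
    exact_mod_cast this.symm
  have p1 := (asc_pos ν k).ne'
  have p2 := (wt_pos (μ + ν + 2 * k) m).ne'
  have p3 : (m.factorial : ℝ) ≠ 0 := by positivity
  have p4 : ((m + k).descFactorial k : ℝ) ≠ 0 := by
    rw [Nat.cast_ne_zero, Ne, Nat.descFactorial_eq_zero_iff_lt]
    omega
  rw [tau_zero_left, relWt, h0, one_mul, zero_add, Nat.add_sub_cancel, wt, wt.eq_1 (ν + k), h3,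
    ← h2]
  field_simp
  rw [h1]
  ring

/-- This is the diagonal of the partial trace of `P_k^* P_k`; the point is that the value does not
depend on `a`. Row `0` is Gauss' sum, and the telescoping identity carries the value from each row
to the next, its boundary term at `b = 0` vanishing through the factor `b`. -/
theorem hasSum_tau_sq (μ ν k a : ℕ) [hμ : Fact (1 < μ)] [hν : Fact (1 < ν)] :
    HasSum (fun b => cst μ ν k ^ 2 * (tau μ ν k a b ^ 2 * relWt μ ν k a b))
      (((μ : ℝ) + ν + 2 * k - 1) / (μ - 1)) := by
  induction a with
  | zero =>
    have hz : ∀ b ∉ Set.range (fun m => m + k),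
        cst μ ν k ^ 2 * (tau μ ν k 0 b ^ 2 * relWt μ ν k 0 b) = 0 := by
      intro b hb
      rw [tau_eq_zero μ ν (show 0 + b < k by
        by_contra h
        exact hb ⟨b - k, by simp only; omega⟩)]
      ring
    rw [← Function.Injective.hasSum_iff (add_left_injective k) hz]
    simp only [Function.comp_def, tau_sq_zero_left]
    obtain ⟨m, rfl⟩ : ∃ m, μ = m + 2 := ⟨μ - 2, by have := hμ.out; omega⟩
    obtain ⟨n, rfl⟩ : ∃ n, ν = n + 1 := ⟨ν - 1, by have := hν.out; omega⟩
    have h := ((hasSum_gauss k (n + k) m).mul_left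
      (k.factorial / (n + 1).ascFactorial k : ℝ)).mul_left (cst (m + 2) (n + 1) k ^ 2)
    rw [show k + (n + k) + m + 3 = m + 2 + (n + 1) + 2 * k by ring,
      show n + k + 1 = n + 1 + k by ring] at h
    refine hasSum_congr_value h ?_
    have asc : ∀ l i : ℕ, ((l + 1).ascFactorial i : ℝ) = (l + i).factorial / l.factorial := by
      intro l i
      rw [eq_div_iff (by positivity), mul_comm]
      exact_mod_cast Nat.factorial_mul_ascFactorial l i
    rw [cst, Real.sq_sqrt (by positivity), show m + 2 + (n + 1) + k - 1 = m + n + k + 1 + 1 by omega,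
      asc n k, asc (m + 1) k, asc (m + n + k + 1) k,
      show k + (n + k) + m + 2 = m + n + k + 1 + k + 1 by ring,
      Nat.factorial_succ (m + n + k + 1 + k),
      show m + 1 + k = k + m + 1 by ring, show n + k + m + 1 = m + n + k + 1 by ring,
      Nat.factorial_succ m]
    push_cast
    rw [show (m : ℝ) + 2 - 1 = m + 1 by ring]
    field_simp
    ring
  | succ a ih =>
    have h := hasSum_of_telescope ih (g := fun b => cst μ ν k ^ 2 *
        (tau μ ν k (a + 1) b ^ 2 * relWt μ ν k (a + 1) b))
      (H := fun b => cst μ ν k ^ 2 * ((b : ℝ) / (a + 1) * relWt μ ν k a b *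
        (tau μ ν k (a + 1) (b - 1) * tau μ ν k a b)))
      (fun b => by
        have := relWt_pos μ ν k (a + 1) b
        positivity)
      (fun b => by
        rw [tau_sq_telescope μ ν k a b]
        ring)
      (by simpa using (tendsto_telescope_zero μ ν k a).const_mul (cst μ ν k ^ 2))
    simpa using h

end Sums

/-! ### Operators on the Hilbert space tensor product. -/

section Tensor

variable {E F G : Type} [NormedAddCommGroup E] [InnerProductSpace ℂ E]
  [NormedAddCommGroup F] [InnerProductSpace ℂ F] [NormedAddCommGroup G] [NormedSpace ℂ G]

/-- The bounded operator `x ↦ x ⊗ y`. -/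
def htmulRight (E : Type) {F : Type} [NormedAddCommGroup E] [InnerProductSpace ℂ E]
    [NormedAddCommGroup F] [InnerProductSpace ℂ F] (y : F) : E →L[ℂ] HTensor E F :=
  (UniformSpace.Completion.toComplL (𝕜 := ℂ)).comp ((TensorProduct.mkL ℂ E F).flip y)

/-- The bounded operator `y ↦ x ⊗ y`. -/
def htmulLeft {E : Type} (F : Type) [NormedAddCommGroup E] [InnerProductSpace ℂ E]
    [NormedAddCommGroup F] [InnerProductSpace ℂ F] (x : E) : F →L[ℂ] HTensor E F :=
  (UniformSpace.Completion.toComplL (𝕜 := ℂ)).comp (TensorProduct.mkL ℂ E F x)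

theorem htensor_ext {S T : HTensor E F →L[ℂ] G} (h : ∀ x y, S (htmul x y) = T (htmul x y)) :
    S = T := by
  refine ContinuousLinearMap.ext fun v => ?_
  induction v using UniformSpace.Completion.induction_on with
  | hp => exact isClosed_eq S.continuous T.continuous
  | ih v =>
    have h1 : S.toLinearMap ∘ₗ (UniformSpace.Completion.toComplL (𝕜 := ℂ)).toLinearMap =
        T.toLinearMap ∘ₗ (UniformSpace.Completion.toComplL (𝕜 := ℂ)).toLinearMap :=
      TensorProduct.ext' h
    exact LinearMap.congr_fun h1 v

theorem htensor_ext_basis {ι κ : Type} (b : HilbertBasis ι ℂ E) (c : HilbertBasis κ ℂ F)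
    {S T : HTensor E F →L[ℂ] G} (h : ∀ i j, S (htmul (b i) (c j)) = T (htmul (b i) (c j))) :
    S = T := by
  refine htensor_ext fun x y => ?_
  have h1 : ∀ i, S ∘L htmulLeft F (b i) = T ∘L htmulLeft F (b i) := fun i => dense_ext c (h i)
  have h2 : S ∘L htmulRight E y = T ∘L htmulRight E y :=
    dense_ext b fun i => DFunLike.congr_fun (h1 i) y
  exact DFunLike.congr_fun h2 x

theorem inner_htmul (x x' : E) (y y' : F) :
    ⟪htmul x y, htmul x' y'⟫_ℂ = ⟪x, x'⟫_ℂ * ⟪y, y'⟫_ℂ := by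
  simp only [htmul, UniformSpace.Completion.inner_coe, TensorProduct.inner_tmul]

theorem tensorId_comp (F : Type) [NormedAddCommGroup F] [InnerProductSpace ℂ F]
    (A B : E →L[ℂ] E) : tensorId F (A ∘L B) = tensorId F A ∘L tensorId F B :=
  htensor_ext fun x y => by
    simp only [tensorId_htmul, ContinuousLinearMap.comp_apply]

theorem tensorId_adjoint (F : Type) [NormedAddCommGroup F] [InnerProductSpace ℂ F]
    [CompleteSpace E] (A : E →L[ℂ] E) : tensorId F A.adjoint = (tensorId F A).adjoint := by
  refine htensor_ext fun x y => ?_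
  refine ext_inner_left ℂ fun v => ?_
  -- Passing to the functionals `⟨v, ·⟩` allows testing on elementary tensors in the other variable
  -- as well.
  have h : innerSL ℂ (tensorId F A.adjoint (htmul x y)) =
      innerSL ℂ ((tensorId F A).adjoint (htmul x y)) := by
    refine htensor_ext fun x' y' => ?_
    rw [innerSL_apply_apply, innerSL_apply_apply, ContinuousLinearMap.adjoint_inner_left,
      tensorId_htmul, tensorId_htmul, inner_htmul, inner_htmul,
      ContinuousLinearMap.adjoint_inner_left]
  have h2 := DFunLike.congr_fun h v
  rw [innerSL_apply_apply, innerSL_apply_apply] at h2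
  rw [← inner_conj_symm, h2, inner_conj_symm]

end Tensor

/-! ### The partial trace of the projection and the trace of the channel. -/

section Channel

variable {μ ν k : ℕ} [Fact (1 < μ)] [Fact (1 < ν)]

/-- The orthonormal basis of normalized monomials of the tensor product. -/
def tensorBasis (μ ν : ℕ) [Fact (1 < μ)] [Fact (1 < ν)] :
    HilbertBasis (ℕ × ℕ) ℂ (HTensor (Bergman μ) (Bergman ν)) :=
  HilbertBasis.mkOfOrthogonalEqBot (orthonormal_htmul μ ν) <| by
    rw [Submodule.eq_bot_iff]
    intro v hv
    have h : innerSL ℂ v = 0 := by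
      refine htensor_ext_basis (basis μ) (basis ν) fun a b => ?_
      have h1 : ⟪htmul (e μ a) (e ν b), v⟫_ℂ = 0 := hv _ (Submodule.subset_span ⟨(a, b), rfl⟩)
      rw [innerSL_apply_apply, basis_apply, basis_apply, ← inner_conj_symm, h1]
      simp
    have h2 := DFunLike.congr_fun h v
    rw [innerSL_apply_apply] at h2
    exact inner_self_eq_zero.1 h2

theorem tensorBasis_apply (p : ℕ × ℕ) : tensorBasis μ ν p = htmul (e μ p.1) (e ν p.2) :=
  congrFun (HilbertBasis.coe_mkOfOrthogonalEqBot (orthonormal_htmul μ ν) _) p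

/-- `proj` is known only through its defining properties; its values on elementary tensors already
identify it with the explicit adjoint. -/
theorem proj_eq_adjoint_emb (μ ν k : ℕ) [Fact (1 < μ)] [Fact (1 < ν)] :
    proj μ ν k = (emb μ ν k).toContinuousLinearMap.adjoint := by
  refine htensor_ext fun f g => DFunLike.ext _ _ fun ζ => ?_
  by_cases hζ : ζ ∈ 𝔻
  · rw [proj_htmul μ ν k f g ζ hζ, adjoint_emb_apply f g hζ]
  · rw [eq_zero_of_notMem _ hζ, eq_zero_of_notMem _ hζ]

/-- The operator `f ↦ P_k (f ⊗ e_j)`. -/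
def slice (μ ν k j : ℕ) [Fact (1 < μ)] [Fact (1 < ν)] : Bergman μ →L[ℂ] Bergman (μ + ν + 2 * k) :=
  proj μ ν k ∘L htmulRight (Bergman μ) (e ν j)

theorem slice_apply (j : ℕ) (f : Bergman μ) : slice μ ν k j f = proj μ ν k (htmul f (e ν j)) := rfl

/-- On monomials `slice` is a weighted shift, `e_a ↦ cf · e_{a+j-k}`. Both sides are continuous
linear in `f`, so checking on the basis is enough. -/
theorem inner_slice (j n : ℕ) (f : Bergman μ) :
    ⟪e (μ + ν + 2 * k) n, slice μ ν k j f⟫_ℂ =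
      if j ≤ n + k then (cf μ ν k n (n + k - j, j) : ℂ) * ⟪e μ (n + k - j), f⟫_ℂ else 0 := by
  have h : innerSL ℂ (e (μ + ν + 2 * k) n) ∘L slice μ ν k j =
      if j ≤ n + k then (cf μ ν k n (n + k - j, j) : ℂ) • innerSL ℂ (e μ (n + k - j)) else 0 := by
    refine dense_ext (basis μ) fun a => ?_
    rw [basis_apply, ContinuousLinearMap.comp_apply, innerSL_apply_apply, slice_apply,
      proj_eq_adjoint_emb, ContinuousLinearMap.adjoint_inner_right,
      LinearIsometry.coe_toContinuousLinearMap, emb_e, inner_vec_htmul n (a, j)]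
    split_ifs with h1 h2 h2
    · have : n + k - j = a := by simp only at h1; omega
      rw [this, _root_.smul_apply, innerSL_apply_apply,
        orthonormal_iff_ite.1 (orthonormal_e μ), if_pos rfl, smul_eq_mul, mul_one]
    · simp only at h1; omega
    · have : n + k - j ≠ a := by simp only at h1; omega
      rw [_root_.smul_apply, innerSL_apply_apply,
        orthonormal_iff_ite.1 (orthonormal_e μ), if_neg this, smul_zero]
    · rfl
  have h2 := DFunLike.congr_fun h f
  rw [ContinuousLinearMap.comp_apply, innerSL_apply_apply] at h2
  rw [h2]
  split_ifs <;> rfl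

/-- For each `n` at most one `a` contributes. Keeping the sum over `a` with an indicator lets all
later sums be interchanged freely in `ℝ≥0∞`. -/
theorem enorm_slice_sq (j : ℕ) (f : Bergman μ) :
    ‖slice μ ν k j f‖ₑ ^ 2 = ∑' n, ∑' a, if a + j = n + k then
      ENNReal.ofReal (cf μ ν k n (a, j) ^ 2) * ‖⟪e μ a, f⟫_ℂ‖ₑ ^ 2 else 0 := by
  rw [← tsum_enorm_inner_sq (basis (μ + ν + 2 * k))]
  refine tsum_congr fun n => ?_
  rw [basis_apply, inner_slice]
  split_ifs with h
  · rw [tsum_eq_single (n + k - j) fun a ha => if_neg (by omega), if_pos (by omega), enorm_mul,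
      mul_pow]
    congr 1
    rw [← ofReal_norm, Complex.norm_real, ← ENNReal.ofReal_pow (norm_nonneg _), Real.norm_eq_abs,
      sq_abs]
  · have : ∀ a, ¬ a + j = n + k := fun a => by omega
    simp [this]

theorem tsum_cf_sq (a j : ℕ) :
    ∑' n, (if a + j = n + k then ENNReal.ofReal (cf μ ν k n (a, j) ^ 2) else 0) =
      ENNReal.ofReal (cst μ ν k ^ 2 * (tau μ ν k a j ^ 2 * relWt μ ν k a j)) := by
  by_cases h : k ≤ a + j
  · rw [tsum_eq_single (a + j - k) fun n hn => if_neg (by omega), if_pos (by omega), cf]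
    change ENNReal.ofReal ((cst μ ν k * tau μ ν k a j * √(relWt μ ν k a j)) ^ 2) = _
    rw [mul_pow, mul_pow, Real.sq_sqrt (relWt_pos μ ν k a j).le, mul_assoc]
  · have h1 : ∀ n, ¬ a + j = n + k := fun n => by omega
    rw [tau_eq_zero μ ν (by omega)]
    simp [h1]

/-- For fixed `j`, distinct `e_a` go to multiples of distinct basis vectors, so there are no cross
terms. The coefficient of `|⟨e_a, f⟩|²` is the row sum of `hasSum_tau_sq`. -/
theorem tsum_enorm_slice_sq (μ ν k : ℕ) [hμ : Fact (1 < μ)] [Fact (1 < ν)] (f : Bergman μ) :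
    ∑' j, ‖slice μ ν k j f‖ₑ ^ 2 =
      ENNReal.ofReal (((μ : ℝ) + ν + 2 * k - 1) / (μ - 1)) * ‖f‖ₑ ^ 2 := by
  calc ∑' j, ‖slice μ ν k j f‖ₑ ^ 2
      = ∑' j, ∑' a, ENNReal.ofReal (cst μ ν k ^ 2 * (tau μ ν k a j ^ 2 * relWt μ ν k a j)) *
          ‖⟪e μ a, f⟫_ℂ‖ₑ ^ 2 := by
        refine tsum_congr fun j => ?_
        rw [enorm_slice_sq, ENNReal.tsum_comm]
        refine tsum_congr fun a => ?_
        rw [← tsum_cf_sq, ← ENNReal.tsum_mul_right]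
        refine tsum_congr fun n => ?_
        rw [ite_mul, zero_mul]
    _ = ∑' a, ENNReal.ofReal (((μ : ℝ) + ν + 2 * k - 1) / (μ - 1)) * ‖⟪e μ a, f⟫_ℂ‖ₑ ^ 2 := by
        rw [ENNReal.tsum_comm]
        refine tsum_congr fun a => ?_
        have h := hasSum_tau_sq μ ν k a
        rw [ENNReal.tsum_mul_right, ← h.tsum_eq, ENNReal.ofReal_tsum_of_nonneg _ h.summable]
        intro j
        have := relWt_pos μ ν k a j
        positivity
    _ = _ := by
        rw [ENNReal.tsum_mul_left, ← tsum_enorm_inner_sq (basis μ)]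
        simp only [basis_apply]

theorem ratio_nonneg (μ ν k : ℕ) [hμ : Fact (1 < μ)] :
    (0 : ℝ) ≤ ((μ : ℝ) + ν + 2 * k - 1) / (μ - 1) := by
  have h : (1 : ℝ) < μ := by exact_mod_cast hμ.out
  refine div_nonneg ?_ (by linarith)
  linarith [show (0 : ℝ) ≤ ν + 2 * k by positivity]

theorem hasSum_norm_slice_sq (μ ν k : ℕ) [Fact (1 < μ)] [Fact (1 < ν)] (f : Bergman μ) :
    HasSum (fun j => ((‖slice μ ν k j f‖ : ℂ) ^ 2))
      ((((μ : ℝ) + ν + 2 * k - 1) / (μ - 1) : ℝ) * (‖f‖ : ℂ) ^ 2) := by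
  have h := tsum_enorm_slice_sq μ ν k f
  have hfin : ∑' j, ‖slice μ ν k j f‖ₑ ^ 2 ≠ ⊤ := by
    rw [h]
    exact ENNReal.mul_ne_top ENNReal.ofReal_ne_top (by simp)
  have h1 := ENNReal.hasSum_toReal hfin
  rw [← ENNReal.tsum_toReal_eq (fun j => by simp), h, ENNReal.toReal_mul,
    ENNReal.toReal_ofReal (ratio_nonneg μ ν k)] at h1
  simp only [ENNReal.toReal_pow, toReal_enorm] at h1
  have h2 := Complex.hasSum_ofReal.2 h1
  simp only [ofReal_mul, ofReal_pow] at h2 ⊢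
  exact h2

/-- The partial trace of the projection `P_k^* P_k` over `𝓗_ν` is a multiple of the identity. -/
theorem hasSum_inner_slice (f g : Bergman μ) :
    HasSum (fun j => ⟪slice μ ν k j f, slice μ ν k j g⟫_ℂ)
      ((((μ : ℝ) + ν + 2 * k - 1) / (μ - 1) : ℝ) * ⟪f, g⟫_ℂ) := by
  have h := hasSum_norm_slice_sq μ ν k
  -- Polarization of the norm identity, on both sides at once.
  have h1 := (((h (f + g)).sub (h (f - g))).add
    (((h (f - I • g)).sub (h (f + I • g))).mul_right I)).div_const 4
  simp only [map_add, map_sub, map_smul] at h1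
  have h2 : ∀ (κ : ℕ) [Fact (1 < κ)] (x y : Bergman κ), ⟪x, y⟫_ℂ =
      ((‖x + y‖ : ℂ) ^ 2 - (‖x - y‖ : ℂ) ^ 2 +
        ((‖x - I • y‖ : ℂ) ^ 2 - (‖x + I • y‖ : ℂ) ^ 2) * I) / 4 := fun κ _ x y =>
    inner_eq_sum_norm_sq_div_four x y
  simp only [← h2] at h1
  have h3 := h2 μ f g
  have h4 : ∀ c u v w z : ℂ, (c * u - c * v + (c * w - c * z) * I) / 4 =
      c * ((u - v + (w - z) * I) / 4) := fun c u v w z => by ring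
  rwa [h4, ← h3] at h1

/-- The operator `(A ⊗ I_ν) P_k^*`. -/
def dilation (μ ν k : ℕ) [Fact (1 < μ)] [Fact (1 < ν)] (A : Bergman μ →L[ℂ] Bergman μ) :
    Bergman (μ + ν + 2 * k) →L[ℂ] HTensor (Bergman μ) (Bergman ν) :=
  tensorId (Bergman ν) A ∘L (proj μ ν k).adjoint

theorem adjoint_dilation (A : Bergman μ →L[ℂ] Bergman μ) :
    (dilation μ ν k A).adjoint = proj μ ν k ∘L tensorId (Bergman ν) A.adjoint := by
  rw [dilation, ContinuousLinearMap.adjoint_comp, ContinuousLinearMap.adjoint_adjoint,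
    tensorId_adjoint]

theorem adjoint_dilation_tensorBasis (A : Bergman μ →L[ℂ] Bergman μ) (p : ℕ × ℕ) :
    (dilation μ ν k A).adjoint (tensorBasis μ ν p) = slice μ ν k p.2 (A.adjoint (e μ p.1)) := by
  rw [adjoint_dilation, tensorBasis_apply, ContinuousLinearMap.comp_apply, tensorId_htmul,
    slice_apply]

theorem channel_apply (A : Bergman μ →L[ℂ] Bergman μ) :
    channel μ ν k A = proj μ ν k ∘L tensorId (Bergman ν) A ∘L (proj μ ν k).adjoint := rfl

/-- The Stinespring form of the channel, from `A† B ⊗ I = (A ⊗ I)† (B ⊗ I)`. -/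
theorem channel_adjoint_comp (A B : Bergman μ →L[ℂ] Bergman μ) :
    channel μ ν k (A.adjoint ∘L B) = (dilation μ ν k A).adjoint ∘L dilation μ ν k B := by
  rw [adjoint_dilation, dilation]
  rw [channel_apply, tensorId_comp, ContinuousLinearMap.comp_assoc, ContinuousLinearMap.comp_assoc]

/-- Summing `‖slice j (A† e_a)‖²` over `j` and then `a` gives `c ∑ ‖A† e_a‖²`: dilation multiplies
the squared Hilbert–Schmidt norm by `c`. -/
theorem IsHilbertSchmidt.dilation {A : Bergman μ →L[ℂ] Bergman μ} (hA : IsHilbertSchmidt A) :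
    IsHilbertSchmidt (dilation μ ν k A) := by
  have h : IsHilbertSchmidt (SU11.dilation μ ν k A).adjoint := by
    refine IsHilbertSchmidt.of_basis (tensorBasis μ ν) ?_
    simp only [adjoint_dilation_tensorBasis]
    rw [ENNReal.tsum_prod (f := fun a j => ‖slice μ ν k j (A.adjoint (e μ a))‖ₑ ^ 2)]
    simp only [tsum_enorm_slice_sq]
    rw [ENNReal.tsum_mul_left]
    refine ENNReal.mul_ne_top ENNReal.ofReal_ne_top ?_
    have := hA.adjoint _ (basis μ)
    simpa only [basis_apply] using this
  simpa only [ContinuousLinearMap.adjoint_adjoint] using h.adjoint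

theorem hasTrace_channel {B C : Bergman μ →L[ℂ] Bergman μ} (hB : IsHilbertSchmidt B)
    (hC : IsHilbertSchmidt C) {t : ℂ}
    (ht : HasSum (fun a => ⟪C.adjoint (basis μ a), B.adjoint (basis μ a)⟫_ℂ) t) :
    HasTrace (channel μ ν k (B.adjoint ∘L C)) (((μ : ℂ) + ν + 2 * k - 1) / (μ - 1) * t) := by
  rw [channel_adjoint_comp]
  refine (hB.dilation).hasTrace hC.dilation (tensorBasis μ ν) ?_
  -- Convergence over pairs `(a, j)` comes first, from the Hilbert–Schmidt property. Only then may
  -- the sum be evaluated iteratively, over `j` by the partial trace and over `a` by `ht`, which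
  -- identifies `t'`.
  obtain ⟨t', -, h⟩ := (hB.dilation (ν := ν) (k := k)).exists_hasSum_inner hC.dilation
    (basis (μ + ν + 2 * k)) (tensorBasis μ ν)
  have h1 := h
  simp only [adjoint_dilation_tensorBasis] at h1
  have h2 := h1.prod_fiberwise fun a => hasSum_inner_slice (C.adjoint (e μ a)) (B.adjoint (e μ a))
  simp only [basis_apply] at ht
  have h3 := h2.unique (ht.mul_left _)
  rw [h3] at h
  push_cast at h
  exact h

end Channel

end SU11

end

theorem mainTheorem6 (μ ν k : ℕ) [Fact (1 < μ)] [Fact (1 < ν)] :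
    SU11.IsCompletelyPositive (SU11.channel μ ν k) ∧
      ∀ A : SU11.Bergman μ →L[ℂ] SU11.Bergman μ, SU11.IsTraceClass A →
        SU11.IsTraceClass (SU11.channel μ ν k A) ∧
          ∃ t : ℂ, SU11.HasTrace A t ∧
            SU11.HasTrace (SU11.channel μ ν k A) (((μ : ℂ) + ν + 2 * k - 1) / (μ - 1) * t) := by
  refine ⟨SU11.isCompletelyPositive_of_apply_adjoint_comp _ _ SU11.channel_adjoint_comp, fun A hA => ?_⟩
  obtain ⟨B, C, hB, hC, rfl⟩ := hA.exists_factor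
  -- The trace of `A` is recorded in its adjoint form `∑ ⟨C† e_a, B† e_a⟩`, the form that the
  -- partial trace produces for the channel, so one `t` serves both traces.
  obtain ⟨t, -, ht⟩ := hB.exists_hasSum_inner hC (SU11.basis μ) (SU11.basis μ)
  refine ⟨?_, t, hB.hasTrace hC (SU11.basis μ) ht, SU11.hasTrace_channel hB hC ht⟩
  rw [SU11.channel_adjoint_comp]
  exact hB.dilation.isTraceClass hC.dilation
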